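/- Let $d\ge 1$, $\mathcal U=[-1,1]^d$, and let $\varrho$ be the uniform probability measure $2^{-d}\,\mathrm dy$ on $\mathcal U$. Let $\Psi_n=\sqrt{2n+1}\,P_n$ $(n\in\mathbb N_0)$, where $P_n$ is the $n$th Legendre polynomial, and $\Psi_\nu(y)=\prod_{j=1}^d\Psi_{\nu_j}(y_j)$ for $\nu\in\mathbb N_0^d$. Let $\boldsymbol\rho=(\rho_1,\dots,\rho_d)$ with all $\rho_j>1$, and let $\mathcal E_{\boldsymbol\rho}=\prod_{j=1}^d\{\tfrac12(z+z^{-1}): z\in\mathbb C,\ 1\le|z|\le\rho_j\}\subset\mathbb C^d$ be the Bernstein polyellipse. For every $\epsilon>0$ there is $\bar s=\bar s(d,\epsilon,\boldsymbol\rho)\in\mathbb N$ such that the following holds. Let $\mathcal V$ be a separable real Hilbert space, isometrically and real-linearly embedded in a complex Hilbert space $\mathcal W$ (for instance its complexification, or $\mathcal W=\mathcal V$ if $\mathcal V$ is itself complex). Let $f:\mathcal U\to\mathcal V$ be holomorphic in $\mathcal E_{\boldsymbol\rho}$, i.e. $f$ is the restriction to $\mathcal U$ of a function $F:\mathcal E_{\boldsymbol\rho}\to\mathcal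 W$ that is holomorphic in the interior of $\mathcal E_{\boldsymbol\rho}$, and write $\|f\|_{L^\infty(\mathcal E_{\boldsymbol\rho};\mathcal V)}:=\operatorname{ess\,sup}_{z\in\mathcal E_{\boldsymbol\rho}}\|F(z)\|_{\mathcal W}\in[0,\infty]$. Put $c_\nu=\int_{\mathcal U}f\,\Psi_\nu\,\mathrm d\varrho\in\mathcal V$, and $f_S=\sum_{\nu\in S}c_\nu\Psi_\nu$ for finite $S\subset\mathbb N_0^d$. Then for every integer $s\ge\bar s$ there is a set $S\subset\mathbb N_0^d$ with $|S|\le s$ which is lower (if $\nu\in S$ and $\mu\le\nu$ componentwise, then $\mu\in S$) and for which $$\|f-f_S\|_{L^2_\varrho(\mathcal U;\mathcal V)}\le\|f-f_S\|_{L^\infty(\mathcal U;\mathcal V)}\le\sum_{\nu\notin S}\|\Psi_\nu\|_{L^\infty(\mathcal U)}\|c_\nu\|_{\mathcal V}\le\|f\|_{L^\infty(\mathcal E_{\boldsymbol\rho};\mathcal V)}\exp\Big(-\frac1{d+1}\Big(\frac{s\,d!\prod_{j=1}^d\log\rho_j}{1+\epsilon}\Big)^{1/d}\Big).$$ Furthermore,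 the coefficient error $\|\boldsymbol c-\boldsymbol c_S\|_{1,\mathcal V}=\sum_{\nu\in\mathbb N_0^d}\|c_\nu-(\boldsymbol c_S)_\nu\|_{\mathcal V}$, where $(\boldsymbol c_S)_\nu=c_\nu$ if $\nu\in S$ and $0$ otherwise, is bounded by the same right-hand side. -/

import Mathlib

open MeasureTheory
open scoped ENNReal Nat

universe u v

noncomputable section

/-- The cube `[-1,1]^d`. -/
def symCube (d : ℕ) : Set (Fin d → ℝ) := {y | ∀ j, y j ∈ Set.Icc (-1 : ℝ) 1}

/-- The uniform probability measure `2^{-d} dy` on the cube `[-1,1]^d`. -/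
def uniformCube (d : ℕ) : Measure (Fin d → ℝ) :=
  ((2 : ℝ≥0∞) ^ d)⁻¹ • (volume.restrict (symCube d))

/-- The Bernstein ellipse `{(z + z⁻¹)/2 : z ∈ ℂ, 1 ≤ |z| ≤ r}`. -/
def bernsteinEllipse (r : ℝ) : Set ℂ :=
  {w | ∃ z : ℂ, 1 ≤ ‖z‖ ∧ ‖z‖ ≤ r ∧ w = (1 / 2 : ℂ) * (z + z⁻¹)}

/-- The Bernstein polyellipse, the product of the Bernstein ellipses of parameters `ρ j`. -/
def bernsteinPolyellipse {d : ℕ} (ρ : Fin d → ℝ) : Set (Fin d → ℂ) :=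
  {z | ∀ j, z j ∈ bernsteinEllipse (ρ j)}

/-- The classical Legendre polynomial `P_n`, by Rodrigues' formula
`P_n = (2^n n!)⁻¹ (d/dx)^n (x^2 - 1)^n`. -/
def legendrePoly (n : ℕ) : Polynomial ℝ :=
  Polynomial.C (1 / ((2 : ℝ) ^ n * (n ! : ℝ))) *
    (Polynomial.derivative^[n] ((Polynomial.X ^ 2 - 1) ^ n))

/-- The univariate Legendre polynomial `√(2n+1) P_n`, orthonormal for `dy/2` on `[-1,1]`. -/
def legendreOrtho (n : ℕ) (x : ℝ) : ℝ :=
  Real.sqrt (2 * (n : ℝ) + 1) * (legendrePoly n).eval x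

/-- The tensor Legendre polynomial `Ψ_ν`. -/
def tensorLegendre {d : ℕ} (ν : Fin d → ℕ) (y : Fin d → ℝ) : ℝ :=
  ∏ j, legendreOrtho (ν j) (y j)

section Coefficients

variable {d : ℕ} {V : Type*} [NormedAddCommGroup V] [NormedSpace ℝ V]

/-- The Legendre coefficient `c_ν = ∫ f Ψ_ν dϱ` of `f`, with `ϱ` the uniform measure. -/
def legendreCoeff (f : (Fin d → ℝ) → V) (ν : Fin d → ℕ) : V :=
  ∫ y, tensorLegendre ν y • f y ∂(uniformCube d)

/-- The truncated Legendre expansion `f_S = ∑_{ν ∈ S} c_ν Ψ_ν`. -/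
def legendreTrunc (f : (Fin d → ℝ) → V) (S : Finset (Fin d → ℕ)) (y : Fin d → ℝ) : V :=
  ∑ ν ∈ S, tensorLegendre ν y • legendreCoeff f ν

end Coefficients

/-- The sequence `c_S`: equal to `c` on `S` and to zero elsewhere. -/
def seqTrunc {I V : Type*} [DecidableEq I] [Zero V] (c : I → V) (S : Finset I) (ν : I) : V :=
  if ν ∈ S then c ν else 0

/-- The norm `‖v‖_{1,V} = ∑_ν ‖v_ν‖` of a family in `V`, with value in `[0,∞]`. -/
def ell1Norm {I V : Type*} [NormedAddCommGroup V] (v : I → V) : ℝ≥0∞ := ∑' ν, ‖v ν‖ₑ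

/-- `F` is a holomorphic extension of `f : [-1,1]^d → V` to the Bernstein polyellipse of parameter
`ρ`. The real Hilbert space `V` is seen inside the complex Hilbert space `W` through the isometry
`ι`: `W` is the complexification of `V`, or `W = V` and `ι = id` when `V` is itself complex.
Only the values of `f` on the cube matter. The polyellipse is closed, and holomorphy is asked only
in its interior, so that functions holomorphic in an open neighbourhood of it are covered. -/
def IsHolomorphicExtension {d : ℕ} {V W : Type*}
    [NormedAddCommGroup V] [InnerProductSpace ℝ V]
    [NormedAddCommGroup W] [InnerProductSpace ℂ W]
    (ι : V →ₗᵢ[ℝ] W) (ρ : Fin d → ℝ) (f : (Fin d → ℝ) → V) (F : (Fin d → ℂ) → W) : Prop :=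
  DifferentiableOn ℂ F (interior (bernsteinPolyellipse ρ)) ∧
    ∀ y ∈ symCube d, F (fun j => (y j : ℂ)) = ι (f y)

/-- The norm `‖F‖_{L^∞(E_ρ)}`: the essential supremum over the polyellipse. -/
def polyellipseNorm {d : ℕ} {W : Type*} [NormedAddCommGroup W]
    (ρ : Fin d → ℝ) (F : (Fin d → ℂ) → W) : ℝ≥0∞ :=
  eLpNorm F ∞ (volume.restrict (bernsteinPolyellipse ρ))

/-- The factor `exp (-(1/(d+1)) (s d! ∏_j log ρ_j / (1+ε))^{1/d})`. -/
def expRate {d : ℕ} (ρ : Fin d → ℝ) (ε : ℝ) (s : ℕ) : ℝ :=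
  Real.exp (-(1 / ((d : ℝ) + 1)) *
    (((s : ℝ) * (d ! : ℝ) * (∏ j, Real.log (ρ j))) / (1 + ε)) ^ (1 / (d : ℝ)))

end

/-! The rate leaves room. Since `d! ≤ d ^ d`, it suffices to reach `exp (-(d/(d+1)) (s ∏ log
ρ_j)^{1/d})` (`exp_le_expRate`), and boxes already do this; no simplex is needed. The box of all `ν`
with `max_j ν_j log ρ_j ≤ t` is lower and has about `t ^ d / ∏ log ρ_j` elements, so `t` close to
`(s ∏ log ρ_j)^{1/d}` is allowed. The tail outside it is `O(exp (-α t))` for every `α < 1`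
(`exists_summable_legendreCoeff_bound`). With `d/(d+1) < α < 1`, an exponential gap absorbs all
constants once `s` is large (`exists_forall_exists_indexBox`).

The tail estimate uses holomorphy in one variable at a time. For `ν` outside the box, let `j`
maximise `ν_j log ρ_j`. Pairing `f` with `c_ν` makes the problem scalar, and the other variables are
frozen in `[-1,1]`. The Joukowski map turns the slice into a function on an annulus, so its
Chebyshev coefficients decay geometrically; `Ψ_n` is orthogonal to `T_k` for `|k| < n`, so its
Legendre coefficients decay too (`norm_integral_legendreOrtho_mul_le`). Maximality of `j` lets part
of this decay be shared among all coordinates, which makes the bounds summable over `ν`.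

The passage from coefficients to `f` needs the Legendre series to converge to `f`. When it is
absolutely summable in `L^∞`, its sum has the same coefficients as `f`, and completeness, from
Stone–Weierstrass, gives equality almost everywhere (`ae_hasSum_legendre`). -/

/-! ### Legendre polynomials: Rodrigues' formula, orthogonality, normalisation -/

-- Fewer than `n` derivatives leave a factor `X ^ 2 - 1`; this kills the boundary terms in the
-- integrations by parts at `±1`.
open Polynomial in
lemma eval_iterate_derivative_sq_sub_one_pow {n k : ℕ} (hk : k < n) {a : ℝ} (ha : a ^ 2 = 1) :
    (derivative^[k] ((X ^ 2 - 1 : ℝ[X]) ^ n)).eval a = 0 := by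
  have h : (X ^ 2 - 1 : ℝ[X]) ^ (n - k) ∣ derivative^[k] ((X ^ 2 - 1 : ℝ[X]) ^ n) :=
    pow_sub_dvd_iterate_derivative_of_pow_dvd k dvd_rfl
  obtain ⟨q, hq⟩ := (dvd_pow_self (X ^ 2 - 1 : ℝ[X]) (Nat.sub_ne_zero_of_lt hk)).trans h
  simp [hq, ha]

open Polynomial in
lemma intervalIntegrable_eval (p : ℝ[X]) (a b : ℝ) :
    IntervalIntegrable (fun x => p.eval x) volume a b :=
  p.continuous.intervalIntegrable a b

open Polynomial in
lemma integral_eval_derivative_mul (p q : ℝ[X]) (h₁ : p.eval 1 = 0) (h₂ : p.eval (-1) = 0) :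
    ∫ x in (-1 : ℝ)..1, (derivative p).eval x * q.eval x
      = - ∫ x in (-1 : ℝ)..1, p.eval x * (derivative q).eval x := by
  have h := intervalIntegral.integral_deriv_mul_eq_sub (a := -1) (b := 1)
    (fun x _ => p.hasDerivAt x) (fun x _ => q.hasDerivAt x)
    (intervalIntegrable_eval _ _ _) (intervalIntegrable_eval _ _ _)
  rw [h₁, h₂, intervalIntegral.integral_add] at h
  · linarith
  · exact ((derivative p).continuous.mul q.continuous).intervalIntegrable _ _
  · exact (p.continuous.mul (derivative q).continuous).intervalIntegrable _ _

open Polynomial in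
lemma integral_iterate_derivative_mul (n : ℕ) (q : ℝ[X]) {k : ℕ} (hk : k ≤ n) :
    ∫ x in (-1 : ℝ)..1, (derivative^[n] ((X ^ 2 - 1 : ℝ[X]) ^ n)).eval x * q.eval x
      = (-1) ^ k * ∫ x in (-1 : ℝ)..1,
        (derivative^[n - k] ((X ^ 2 - 1 : ℝ[X]) ^ n)).eval x * (derivative^[k] q).eval x := by
  induction k with
  | zero => simp
  | succ k ih =>
    rw [ih (by omega)]
    obtain ⟨m, hm⟩ : ∃ m, n - k = m + 1 := ⟨n - k - 1, by omega⟩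
    rw [hm, Function.iterate_succ_apply', integral_eval_derivative_mul,
      show n - (k + 1) = m by omega, Function.iterate_succ_apply']
    · ring
    · exact eval_iterate_derivative_sq_sub_one_pow (by omega) (by norm_num)
    · exact eval_iterate_derivative_sq_sub_one_pow (by omega) (by norm_num)

open Polynomial in
/-- Rodrigues' formula integrated by parts `n` times. -/
lemma integral_legendrePoly_mul (n : ℕ) (q : ℝ[X]) :
    ∫ x in (-1 : ℝ)..1, (legendrePoly n).eval x * q.eval x
      = 1 / (2 ^ n * (n ! : ℝ)) *
        ∫ x in (-1 : ℝ)..1, (1 - x ^ 2) ^ n * (derivative^[n] q).eval x := by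
  have h := integral_iterate_derivative_mul n q le_rfl
  simp only [legendrePoly, eval_mul, eval_C, mul_assoc, intervalIntegral.integral_const_mul]
  rw [h, ← intervalIntegral.integral_const_mul]
  congr 2
  ext x
  simp only [Nat.sub_self, Function.iterate_zero, id, eval_pow, eval_sub, eval_X, eval_one]
  rw [← mul_assoc, ← mul_pow]
  ring

open Polynomial in
lemma integral_legendrePoly_mul_eq_zero {n : ℕ} {q : ℝ[X]} (hq : q.natDegree < n) :
    ∫ x in (-1 : ℝ)..1, (legendrePoly n).eval x * q.eval x = 0 := by
  rw [integral_legendrePoly_mul, iterate_derivative_eq_zero hq]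
  simp

open Polynomial in
lemma natDegree_sq_sub_one_pow (n : ℕ) : ((X ^ 2 - 1 : ℝ[X]) ^ n).natDegree = 2 * n := by
  rw [natDegree_pow, show (X ^ 2 - 1 : ℝ[X]) = X ^ 2 - C 1 by simp, natDegree_X_pow_sub_C, mul_comm]

open Polynomial in
lemma coeff_sq_sub_one_pow (n : ℕ) : ((X ^ 2 - 1 : ℝ[X]) ^ n).coeff (2 * n) = 1 := by
  have h : ((X ^ 2 - 1 : ℝ[X]) ^ n).Monic := by
    rw [show (X ^ 2 - 1 : ℝ[X]) = X ^ 2 - C 1 by simp]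
    exact (monic_X_pow_sub_C 1 (by norm_num)).pow n
  have := h.coeff_natDegree
  rwa [natDegree_sq_sub_one_pow] at this

open Polynomial in
lemma natDegree_legendrePoly_le (n : ℕ) : (legendrePoly n).natDegree ≤ n := by
  refine (natDegree_C_mul_le _ _).trans ((natDegree_iterate_derivative _ _).trans ?_)
  rw [natDegree_sq_sub_one_pow]
  omega

open Polynomial in
lemma coeff_legendrePoly (n : ℕ) :
    (legendrePoly n).coeff n = ((2 * n)! : ℝ) / (2 ^ n * (n ! : ℝ) ^ 2) := by
  rw [legendrePoly, coeff_C_mul, coeff_iterate_derivative, ← two_mul, coeff_sq_sub_one_pow]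
  have h := Nat.factorial_mul_descFactorial (show n ≤ 2 * n by omega)
  rw [show 2 * n - n = n by omega] at h
  rw [← h]
  have : (n ! : ℝ) ≠ 0 := by positivity
  push_cast
  simp
  field_simp

open Polynomial in
lemma natDegree_legendrePoly (n : ℕ) : (legendrePoly n).natDegree = n := by
  refine le_antisymm (natDegree_legendrePoly_le n) (le_natDegree_of_ne_zero ?_)
  rw [coeff_legendrePoly]
  positivity

lemma integral_one_sub_sq_pow_succ (n : ℕ) :
    (2 * (n : ℝ) + 3) * ∫ x in (-1 : ℝ)..1, (1 - x ^ 2) ^ (n + 1)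
      = (2 * n + 2) * ∫ x in (-1 : ℝ)..1, (1 - x ^ 2) ^ n := by
  have h : ∫ x in (-1 : ℝ)..1,
      ((2 * (n : ℝ) + 3) * (1 - x ^ 2) ^ (n + 1) - (2 * n + 2) * (1 - x ^ 2) ^ n) = 0 := by
    -- The integrand is the derivative of `x (1 - x²)^(n+1)`, after writing `x² = 1 - (1 - x²)`;
    -- this primitive vanishes at `±1`.
    rw [intervalIntegral.integral_eq_sub_of_hasDerivAt
      (f := fun x : ℝ => x * (1 - x ^ 2) ^ (n + 1))]
    · simp
    · intro x _
      have h1 : HasDerivAt (fun x : ℝ => 1 - x ^ 2) (-(2 * x)) x := by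
        simpa using (hasDerivAt_pow 2 x).const_sub 1
      have h2 := (hasDerivAt_id x).mul (h1.pow (n + 1))
      convert! h2 using 1
      simp
      ring
    · exact (by fun_prop : Continuous _).intervalIntegrable _ _
  rw [intervalIntegral.integral_sub ((by fun_prop : Continuous _).intervalIntegrable _ _)
    ((by fun_prop : Continuous _).intervalIntegrable _ _),
    intervalIntegral.integral_const_mul, intervalIntegral.integral_const_mul] at h
  linarith

lemma integral_one_sub_sq_pow (n : ℕ) :
    ∫ x in (-1 : ℝ)..1, (1 - x ^ 2) ^ n
      = 2 * (2 ^ n * (n ! : ℝ)) ^ 2 / ((2 * n)! * (2 * n + 1)) := by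
  induction n with
  | zero => norm_num
  | succ n ih =>
    have h := integral_one_sub_sq_pow_succ n
    rw [ih] at h
    have h3 : (2 * (n : ℝ) + 3) ≠ 0 := by positivity
    rw [← mul_right_inj' h3, h, show 2 * (n + 1) = 2 * n + 1 + 1 by ring,
      Nat.factorial_succ, Nat.factorial_succ, Nat.factorial_succ]
    have : ((2 * n)! : ℝ) ≠ 0 := by positivity
    have h4 : (2 * (n : ℝ) + 1) ≠ 0 := by positivity
    push_cast
    field_simp
    ring

-- Rodrigues' formula is tested against `P_n` itself, whose `n`th derivative is a constant, so only
-- the integral of `(1 - x²)^n` remains.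
open Polynomial in
lemma integral_legendrePoly_sq (n : ℕ) :
    ∫ x in (-1 : ℝ)..1, (legendrePoly n).eval x * (legendrePoly n).eval x = 2 / (2 * n + 1) := by
  have h : derivative^[n] (legendrePoly n) = C (((2 * n)! : ℝ) / (2 ^ n * (n ! : ℝ))) := by
    rw [eq_C_of_natDegree_le_zero (p := derivative^[n] (legendrePoly n)), coeff_iterate_derivative]
    · rw [Nat.zero_add, Nat.descFactorial_self, coeff_legendrePoly]
      congr 1
      simp
      field_simp
    · exact (natDegree_iterate_derivative _ _).trans (by rw [natDegree_legendrePoly]; omega)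
  rw [integral_legendrePoly_mul, h]
  simp only [eval_C, intervalIntegral.integral_mul_const, integral_one_sub_sq_pow]
  field_simp

lemma integral_legendrePoly_mul_legendrePoly_of_ne {m n : ℕ} (h : m ≠ n) :
    ∫ x in (-1 : ℝ)..1, (legendrePoly m).eval x * (legendrePoly n).eval x = 0 := by
  rcases lt_or_gt_of_ne h with h | h
  · simp_rw [mul_comm (Polynomial.eval _ (legendrePoly m))]
    exact integral_legendrePoly_mul_eq_zero (by rwa [natDegree_legendrePoly])
  · exact integral_legendrePoly_mul_eq_zero (by rwa [natDegree_legendrePoly])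

/-! ### The bound `|P_n| ≤ 1` on `[-1,1]` -/

open Polynomial in
lemma iteratedDeriv_eval_eq (p : ℂ[X]) (n : ℕ) :
    iteratedDeriv n (fun z => p.eval z) = fun z => (derivative^[n] p).eval z := by
  induction n with
  | zero => simp
  | succ n ih =>
    rw [iteratedDeriv_succ, ih, Function.iterate_succ_apply']
    ext z
    exact Polynomial.deriv _

open Polynomial in
/-- Cauchy's estimate for the `n`th derivative of `(w ^ 2 - 1) ^ n` on the circle of centre `x` and
radius `√(1 - x ^ 2)`. -/
lemma abs_eval_legendrePoly_le_of_lt (n : ℕ) {x : ℝ} (hx : x ^ 2 < 1) :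
    |(legendrePoly n).eval x| ≤ 1 := by
  set s := √(1 - x ^ 2) with hs
  have hs0 : 0 < s := Real.sqrt_pos.2 (by linarith)
  have hs2 : s ^ 2 = 1 - x ^ 2 := Real.sq_sqrt (by linarith)
  have hs2' : (s : ℂ) ^ 2 = 1 - (x : ℂ) ^ 2 := by exact_mod_cast hs2
  have hC : ∀ z ∈ Metric.sphere (x : ℂ) s, ‖((X ^ 2 - 1 : ℂ[X]) ^ n).eval z‖ ≤ (2 * s) ^ n := by
    intro z hz
    rw [eval_pow, norm_pow]
    refine pow_le_pow_left₀ (norm_nonneg _) ?_ n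
    have hz' : ‖z - x‖ = s := by simpa [dist_eq_norm] using hz
    obtain ⟨u, rfl⟩ : ∃ u : ℂ, z = x + u := ⟨z - x, by ring⟩
    rw [add_sub_cancel_left] at hz'
    have hu : u * (starRingEnd ℂ) u = s ^ 2 := by
      rw [Complex.mul_conj, Complex.normSq_eq_norm_sq, hz']; push_cast; ring
    -- With `|u|² = s² = 1 - x²`, the term `x² - 1` is `-u ū`, so `u` factors out. The other factor
    -- is `2(x + i Im u)`, of modulus at most `2 √(x² + s²) = 2`.
    have : (X ^ 2 - 1 : ℂ[X]).eval (x + u) = u * (2 * x + (u - (starRingEnd ℂ) u)) := by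
      simp
      linear_combination hu + hs2'
    rw [this, norm_mul, hz', mul_comm 2 s]
    refine mul_le_mul_of_nonneg_left ?_ hs0.le
    rw [Complex.sub_conj]
    have hsq : ‖(2 * x + (2 * u.im : ℝ) * Complex.I : ℂ)‖ ^ 2 ≤ 2 ^ 2 := by
      have : (2 * x + (2 * u.im : ℝ) * Complex.I : ℂ)
          = ((2 * x : ℝ) : ℂ) + ((2 * u.im : ℝ) : ℂ) * Complex.I := by push_cast; ring
      rw [this, ← Complex.normSq_eq_norm_sq, Complex.normSq_add_mul_I]
      have him : u.im ^ 2 ≤ s ^ 2 := by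
        rw [← hz', ← Complex.normSq_eq_norm_sq, Complex.normSq_apply]
        nlinarith [sq_nonneg u.re]
      nlinarith
    exact le_of_sq_le_sq hsq (by norm_num)
  have h := Complex.norm_iteratedDeriv_le_of_forall_mem_sphere_norm_le n hs0
    ((X ^ 2 - 1 : ℂ[X]) ^ n).differentiable.diffContOnCl hC
  rw [iteratedDeriv_eval_eq] at h
  have hmap : (derivative^[n] ((X ^ 2 - 1 : ℂ[X]) ^ n)).eval (x : ℂ)
      = (((derivative^[n] ((X ^ 2 - 1 : ℝ[X]) ^ n)).eval x : ℝ) : ℂ) := by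
    have : (X ^ 2 - 1 : ℂ[X]) ^ n = ((X ^ 2 - 1 : ℝ[X]) ^ n).map Complex.ofRealHom := by simp
    rw [this, iterate_derivative_map, ← Complex.ofRealHom_eq_coe, eval_map_apply,
      Complex.ofRealHom_eq_coe]
  simp only [hmap, Complex.norm_real, Real.norm_eq_abs] at h
  rw [legendrePoly, eval_mul, eval_C, abs_mul, abs_of_nonneg (by positivity)]
  calc _ ≤ 1 / (2 ^ n * (n ! : ℝ)) * ((n ! : ℝ) * (2 * s) ^ n / s ^ n) := by gcongr
    _ = 1 := by rw [mul_pow]; field_simp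

/-- At `±1` the Cauchy circle degenerates to a point, so the endpoints are reached by continuity. -/
lemma abs_eval_legendrePoly_le (n : ℕ) {x : ℝ} (hx : x ∈ Set.Icc (-1 : ℝ) 1) :
    |(legendrePoly n).eval x| ≤ 1 := by
  have hcl : x ∈ closure (Set.Ioo (-1 : ℝ) 1) := by
    rwa [closure_Ioo (by norm_num)]
  refine closure_minimal (t := {x | |(legendrePoly n).eval x| ≤ 1}) (fun y hy => ?_)
    (isClosed_le (by fun_prop) continuous_const) hcl
  exact abs_eval_legendrePoly_le_of_lt n (by nlinarith [hy.1, hy.2])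

/-! ### The uniform measure and the orthonormal tensor system -/

/-- The uniform probability measure on `[-1,1]`. -/
noncomputable def uniformSymInterval : Measure ℝ :=
  (2 : ℝ≥0∞)⁻¹ • (volume.restrict (Set.Icc (-1 : ℝ) 1))

instance isProbabilityMeasure_uniformSymInterval : IsProbabilityMeasure uniformSymInterval := by
  constructor
  simp only [uniformSymInterval, Measure.smul_apply, Measure.restrict_apply MeasurableSet.univ,
    Set.univ_inter, Real.volume_Icc, smul_eq_mul]
  norm_num
  exact ENNReal.inv_mul_cancel (by norm_num) (by norm_num)

lemma symCube_eq_pi (d : ℕ) : symCube d = Set.univ.pi fun _ => Set.Icc (-1 : ℝ) 1 := by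
  ext y; simp only [symCube, Set.mem_ofPred_eq, Set.mem_univ_pi]

lemma measurableSet_symCube (d : ℕ) : MeasurableSet (symCube d) := by
  rw [symCube_eq_pi]; exact MeasurableSet.univ_pi fun _ => measurableSet_Icc

lemma isCompact_symCube (d : ℕ) : IsCompact (symCube d) := by
  rw [symCube_eq_pi]; exact isCompact_univ_pi fun _ => isCompact_Icc

lemma uniformCube_eq_pi (d : ℕ) :
    uniformCube d = Measure.pi fun _ : Fin d => uniformSymInterval := by
  symm
  refine Measure.pi_eq fun s hs => ?_
  rw [uniformCube, Measure.smul_apply, Measure.restrict_apply (MeasurableSet.univ_pi hs),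
    symCube_eq_pi, ← Set.pi_inter_distrib, volume_pi_pi]
  simp only [uniformSymInterval, Measure.smul_apply, smul_eq_mul, Finset.prod_mul_distrib,
    Finset.prod_const, Finset.card_univ, Fintype.card_fin, ENNReal.inv_pow]
  congr 1
  exact Finset.prod_congr rfl fun i _ => (Measure.restrict_apply (hs i)).symm

instance isProbabilityMeasure_uniformCube (d : ℕ) : IsProbabilityMeasure (uniformCube d) := by
  rw [uniformCube_eq_pi]; infer_instance

lemma ae_mem_symCube (d : ℕ) : ∀ᵐ y ∂uniformCube d, y ∈ symCube d :=
  Measure.ae_smul_measure (ae_restrict_mem (measurableSet_symCube d)) _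

lemma ae_mem_Icc_uniformSymInterval : ∀ᵐ x ∂uniformSymInterval, x ∈ Set.Icc (-1 : ℝ) 1 :=
  Measure.ae_smul_measure (ae_restrict_mem measurableSet_Icc) _

lemma integral_uniformSymInterval {E : Type*} [NormedAddCommGroup E] [NormedSpace ℝ E]
    (g : ℝ → E) : ∫ x, g x ∂uniformSymInterval = (2⁻¹ : ℝ) • ∫ x in (-1 : ℝ)..1, g x := by
  rw [uniformSymInterval, integral_smul_measure, intervalIntegral.integral_of_le (by norm_num),
    integral_Icc_eq_integral_Ioc]
  simp

lemma ContinuousOn.aestronglyMeasurable_uniformCube {d : ℕ} {E : Type*} [NormedAddCommGroup E]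
    {g : (Fin d → ℝ) → E} (hg : ContinuousOn g (symCube d)) :
    AEStronglyMeasurable g (uniformCube d) :=
  (hg.aestronglyMeasurable_of_isCompact (isCompact_symCube d) (measurableSet_symCube d)).smul_measure
    _

lemma ContinuousOn.integrable_uniformCube {d : ℕ} {E : Type*} [NormedAddCommGroup E]
    {g : (Fin d → ℝ) → E} (hg : ContinuousOn g (symCube d)) : Integrable g (uniformCube d) := by
  refine Integrable.smul_measure ?_ (by simp)
  exact hg.integrableOn_compact (isCompact_symCube d)

lemma ContinuousOn.integrable_uniformSymInterval {E : Type*} [NormedAddCommGroup E]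
    {g : ℝ → E} (hg : ContinuousOn g (Set.Icc (-1) 1)) : Integrable g uniformSymInterval := by
  refine Integrable.smul_measure ?_ (by simp)
  exact hg.integrableOn_compact isCompact_Icc

lemma continuous_legendreOrtho (n : ℕ) : Continuous (legendreOrtho n) := by
  unfold legendreOrtho; fun_prop

lemma continuous_tensorLegendre {d : ℕ} (ν : Fin d → ℕ) : Continuous (tensorLegendre ν) := by
  unfold tensorLegendre
  exact continuous_finsetProd _ fun j _ => (continuous_legendreOrtho _).comp (continuous_apply j)

lemma abs_legendreOrtho_le (n : ℕ) {x : ℝ} (hx : x ∈ Set.Icc (-1 : ℝ) 1) :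
    |legendreOrtho n x| ≤ √(2 * n + 1) := by
  rw [legendreOrtho, abs_mul, abs_of_nonneg (Real.sqrt_nonneg _)]
  exact mul_le_of_le_one_right (Real.sqrt_nonneg _) (abs_eval_legendrePoly_le n hx)

lemma abs_tensorLegendre_le {d : ℕ} (ν : Fin d → ℕ) {y : Fin d → ℝ} (hy : y ∈ symCube d) :
    |tensorLegendre ν y| ≤ ∏ j, √(2 * ν j + 1) := by
  rw [tensorLegendre, Finset.abs_prod]
  exact Finset.prod_le_prod (fun _ _ => abs_nonneg _) fun j _ => abs_legendreOrtho_le _ (hy j)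

lemma integral_legendreOrtho_mul (m n : ℕ) :
    ∫ x, legendreOrtho m x * legendreOrtho n x ∂uniformSymInterval = if m = n then 1 else 0 := by
  rw [integral_uniformSymInterval]
  have : ∀ x, legendreOrtho m x * legendreOrtho n x = (√(2 * m + 1) * √(2 * n + 1)) *
      ((legendrePoly m).eval x * (legendrePoly n).eval x) := fun x => by
    simp only [legendreOrtho]; ring
  simp_rw [this, intervalIntegral.integral_const_mul]
  split_ifs with h
  · subst h
    rw [integral_legendrePoly_sq, Real.mul_self_sqrt (by positivity)]
    simp
    field_simp
  · simp [integral_legendrePoly_mul_legendrePoly_of_ne h]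

lemma integral_tensorLegendre_mul {d : ℕ} (μ ν : Fin d → ℕ) :
    ∫ y, tensorLegendre μ y * tensorLegendre ν y ∂uniformCube d = if μ = ν then 1 else 0 := by
  simp_rw [uniformCube_eq_pi, tensorLegendre, ← Finset.prod_mul_distrib]
  rw [integral_fintype_prod_eq_prod (f := fun j x => legendreOrtho (μ j) x * legendreOrtho (ν j) x)]
  simp_rw [integral_legendreOrtho_mul]
  split_ifs with h
  · simp [h]
  · obtain ⟨j, hj⟩ := Function.ne_iff.1 h
    exact Finset.prod_eq_zero (Finset.mem_univ j) (if_neg hj)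

lemma integral_legendreOrtho_mul_eval_eq_zero {n : ℕ} {q : Polynomial ℝ} (hq : q.natDegree < n) :
    ∫ x, legendreOrtho n x * q.eval x ∂uniformSymInterval = 0 := by
  simp_rw [integral_uniformSymInterval, legendreOrtho, mul_assoc,
    intervalIntegral.integral_const_mul, integral_legendrePoly_mul_eq_zero hq]
  simp

/-! ### Bernstein ellipses through the Joukowski map -/

/-- The Joukowski map. -/
noncomputable def joukowski (z : ℂ) : ℂ := (1 / 2 : ℂ) * (z + z⁻¹)

/-- The open annulus `r⁻¹ < |z| < r`. -/
def symAnnulus (r : ℝ) : Set ℂ := {z | r⁻¹ < ‖z‖ ∧ ‖z‖ < r}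

/-- The open Bernstein ellipse, the image of an annulus under the Joukowski map. -/
def openEllipse (r : ℝ) : Set ℂ := joukowski '' symAnnulus r

lemma isOpen_symAnnulus (r : ℝ) : IsOpen (symAnnulus r) :=
  (isOpen_lt continuous_const continuous_norm).inter (isOpen_lt continuous_norm continuous_const)

lemma ne_zero_of_mem_symAnnulus {r : ℝ} (hr : 1 < r) {z : ℂ} (hz : z ∈ symAnnulus r) : z ≠ 0 :=
  norm_pos_iff.1 ((inv_pos.2 (by linarith)).trans hz.1)

lemma differentiableOn_joukowski : DifferentiableOn ℂ joukowski {0}ᶜ := by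
  intro z hz
  exact ((differentiableAt_id.add (differentiableAt_inv hz)).const_mul _).differentiableWithinAt

/-- Open mapping theorem on the connected punctured plane; the Joukowski map is not constant there
because its values at `1` and `-1` differ. -/
lemma isOpen_openEllipse {r : ℝ} (hr : 1 < r) : IsOpen (openEllipse r) := by
  have hconn : IsPreconnected ({0}ᶜ : Set ℂ) :=
    (isConnected_compl_singleton_of_one_lt_rank (by simp) 0).isPreconnected
  rcases (differentiableOn_joukowski.analyticOnNhd isOpen_compl_singleton).is_constant_or_isOpen
    hconn with ⟨w, hw⟩ | h
  · have h1 := hw 1 (by simp)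
    have h2 := hw (-1) (by simp)
    rw [← h2] at h1
    norm_num [joukowski] at h1
  · exact h _ (fun z hz => ne_zero_of_mem_symAnnulus hr hz) (isOpen_symAnnulus r)

/-- The Joukowski map is invariant under `z ↦ z⁻¹`, which moves the inner half of the annulus to the
outer half. -/
lemma openEllipse_subset_bernsteinEllipse {r : ℝ} (hr : 1 < r) :
    openEllipse r ⊆ bernsteinEllipse r := by
  rintro _ ⟨z, hz, rfl⟩
  have hz0 : 0 < ‖z‖ := norm_pos_iff.2 (ne_zero_of_mem_symAnnulus hr hz)
  rcases le_total 1 ‖z‖ with h | h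
  · exact ⟨z, h, hz.2.le, rfl⟩
  · refine ⟨z⁻¹, ?_, ?_, ?_⟩
    · rw [norm_inv]; exact (one_le_inv₀ hz0).2 h
    · rw [norm_inv]; exact inv_le_of_inv_le₀ (by linarith) hz.1.le
    · rw [joukowski, inv_inv, add_comm]

lemma joukowski_exp (θ : ℝ) : joukowski (Complex.exp (θ * Complex.I)) = (Real.cos θ : ℂ) := by
  rw [joukowski, ← Complex.exp_neg, Complex.ofReal_cos, Complex.cos]
  ring_nf

lemma exp_mem_symAnnulus {r : ℝ} (hr : 1 < r) (θ : ℝ) :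
    Complex.exp (θ * Complex.I) ∈ symAnnulus r := by
  simp only [symAnnulus, Set.mem_ofPred_eq, Complex.norm_exp_ofReal_mul_I]
  exact ⟨inv_lt_one_of_one_lt₀ hr, hr⟩

lemma ofReal_mem_openEllipse {r : ℝ} (hr : 1 < r) {x : ℝ} (hx : x ∈ Set.Icc (-1 : ℝ) 1) :
    (x : ℂ) ∈ openEllipse r :=
  ⟨_, exp_mem_symAnnulus hr (Real.arccos x), by
    rw [joukowski_exp, Real.cos_arccos hx.1 hx.2]⟩

/-! ### Chebyshev expansion and one-variable coefficient decay -/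

/-- The unit circle can be deformed to any circle in the annulus. Keeping `R` free on both sides of
`1` serves positive and negative frequencies alike. -/
lemma norm_circleIntegral_zpow_mul_le {ρ R M : ℝ} (hR : R ∈ Set.Ioo ρ⁻¹ ρ) (hρ : 1 < ρ)
    {G : ℂ → ℂ} (hG : DifferentiableOn ℂ G (symAnnulus ρ)) (hM : ∀ z ∈ symAnnulus ρ, ‖G z‖ ≤ M)
    (k : ℤ) :
    ‖∮ z in C(0, 1), z ^ (-k - 1) * G z‖ ≤ 2 * Real.pi * M * R ^ (-k) := by
  have hR0 : 0 < R := (inv_pos.2 (by linarith)).trans hR.1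
  have hdiff : ∀ z ∈ symAnnulus ρ, DifferentiableAt ℂ (fun z => z ^ (-k - 1) * G z) z :=
    fun z hz => ((differentiableAt_zpow.2 (Or.inl (ne_zero_of_mem_symAnnulus hρ hz))).mul
      (hG.differentiableAt ((isOpen_symAnnulus ρ).mem_nhds hz)))
  have key : ∀ a b : ℝ, ρ⁻¹ < a → a ≤ b → b < ρ →
      (∮ z in C(0, b), z ^ (-k - 1) * G z) = ∮ z in C(0, a), z ^ (-k - 1) * G z := by
    intro a b ha hab hb
    refine Complex.circleIntegral_eq_of_differentiable_on_annulus_off_countable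
      ((inv_pos.2 (by linarith)).trans ha) hab Set.countable_empty ?_ ?_
    · intro z hz
      refine (hdiff z ⟨?_, ?_⟩).continuousAt.continuousWithinAt
      · have := hz.2; simp at this; linarith
      · have := hz.1; simp at this; linarith
    · intro z hz
      refine hdiff z ⟨?_, ?_⟩
      · have := hz.1.2; simp at this; linarith
      · have := hz.1.1; simp at this; linarith
  have hEq : (∮ z in C(0, 1), z ^ (-k - 1) * G z) = ∮ z in C(0, R), z ^ (-k - 1) * G z := by
    rcases le_total 1 R with h | h
    · exact (key 1 R (inv_lt_one_of_one_lt₀ hρ) h hR.2).symm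
    · exact key R 1 hR.1 h hρ
  rw [hEq]
  have hb : ∀ z ∈ Metric.sphere (0 : ℂ) R, ‖z ^ (-k - 1) * G z‖ ≤ R ^ (-k - 1) * M := by
    intro z hz
    have hz' : ‖z‖ = R := by simpa using hz
    rw [norm_mul, norm_zpow, hz']
    exact mul_le_mul_of_nonneg_left (hM z ⟨hz' ▸ hR.1, hz' ▸ hR.2⟩) (zpow_nonneg hR0.le _)
  refine (circleIntegral.norm_integral_le_of_norm_le_const hR0.le hb).trans_eq ?_
  rw [zpow_sub_one₀ hR0.ne']
  field_simp

/-- The Chebyshev expansion on `[-1,1]` of a function holomorphic in a Bernstein ellipse. -/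
lemma exists_hasSum_chebyshev {ρ r M : ℝ} (hr : 1 < r) (hrρ : r < ρ) {g : ℂ → ℂ}
    (hg : DifferentiableOn ℂ g (openEllipse ρ)) (hM : ∀ w ∈ openEllipse ρ, ‖g w‖ ≤ M) :
    ∃ a : ℤ → ℂ, (∀ k, ‖a k‖ ≤ M * r⁻¹ ^ k.natAbs) ∧ ∀ x ∈ Set.Icc (-1 : ℝ) 1,
      HasSum (fun k => (((Polynomial.Chebyshev.T ℝ k).eval x : ℝ) : ℂ) * a k) (g x) := by
  have hρ : 1 < ρ := hr.trans hrρ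
  have hr0 : 0 < r := by linarith
  set G : ℂ → ℂ := fun z => g (joukowski z) with hGdef
  have hG : DifferentiableOn ℂ G (symAnnulus ρ) :=
    hg.comp (differentiableOn_joukowski.mono fun z hz => ne_zero_of_mem_symAnnulus hρ hz)
      (Set.mapsTo_image _ _)
  have hGM : ∀ z ∈ symAnnulus ρ, ‖G z‖ ≤ M := fun z hz => hM _ ⟨z, hz, rfl⟩
  have : Fact (0 < 2 * Real.pi) := ⟨Real.two_pi_pos⟩
  have hcirc : ∀ t : Circle, (t : ℂ) ∈ symAnnulus ρ := fun t => by
    simp only [symAnnulus, Set.mem_ofPred_eq, Circle.norm_coe]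
    exact ⟨inv_lt_one_of_one_lt₀ hρ, hρ⟩
  let Gc : C(AddCircle (2 * Real.pi), ℂ) :=
    ⟨fun t => G (t.toCircle : ℂ), hG.continuousOn.comp_continuous
      (continuous_subtype_val.comp AddCircle.continuous_toCircle) fun t => hcirc _⟩
  have hGc : ∀ θ : ℝ, Gc (θ : AddCircle (2 * Real.pi)) = G (Complex.exp (θ * Complex.I)) := by
    intro θ
    simp only [Gc, ContinuousMap.coe_mk, AddCircle.toCircle_apply_mk, Circle.coe_exp]
    rw [div_self Real.two_pi_pos.ne', one_mul]
  have hfou : ∀ (k : ℤ) (θ : ℝ), fourier k (θ : AddCircle (2 * Real.pi))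
      = Complex.exp (k * θ * Complex.I) := by
    intro k θ
    rw [fourier_coe_apply]
    congr 1
    have : (Real.pi : ℂ) ≠ 0 := by exact_mod_cast Real.pi_ne_zero
    push_cast
    field_simp
  have hcoeff : ∀ k, fourierCoeff Gc k
      = (2 * Real.pi * Complex.I)⁻¹ * ∮ z in C(0, 1), z ^ (-k - 1) * G z := by
    intro k
    rw [fourierCoeff_eq_intervalIntegral _ _ 0, circleIntegral, zero_add]
    have : ∀ θ : ℝ, deriv (circleMap 0 1) θ • ((circleMap 0 1 θ) ^ (-k - 1) * G (circleMap 0 1 θ))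
        = Complex.I * (fourier (-k) (θ : AddCircle (2 * Real.pi)) •
          Gc (θ : AddCircle (2 * Real.pi))) := by
      intro θ
      rw [hGc, hfou, deriv_circleMap, smul_eq_mul, smul_eq_mul]
      have : circleMap 0 1 θ = Complex.exp (θ * Complex.I) := by simp [circleMap]
      rw [this, zpow_sub_one₀ (Complex.exp_ne_zero _), ← Complex.exp_int_mul]
      have h0 := Complex.exp_ne_zero (θ * Complex.I)
      field_simp
    simp_rw [this, intervalIntegral.integral_const_mul]
    rw [Complex.real_smul]
    have : (Real.pi : ℂ) ≠ 0 := by exact_mod_cast Real.pi_ne_zero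
    push_cast
    field_simp
  have hM0 : 0 ≤ M := (norm_nonneg _).trans (hGM _ (hcirc 1))
  have hbound : ∀ k, ‖fourierCoeff Gc k‖ ≤ M * r⁻¹ ^ k.natAbs := by
    intro k
    have main : ∀ R ∈ Set.Ioo ρ⁻¹ ρ, ‖fourierCoeff Gc k‖ ≤ M * R ^ (-k) := by
      intro R hR
      rw [hcoeff, norm_mul]
      have h := norm_circleIntegral_zpow_mul_le hR hρ hG hGM k
      have h2 : ‖(2 * Real.pi * Complex.I : ℂ)⁻¹‖ = (2 * Real.pi)⁻¹ := by
        simp [abs_of_pos Real.pi_pos]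
      rw [h2]
      calc _ ≤ (2 * Real.pi)⁻¹ * (2 * Real.pi * M * R ^ (-k)) := by gcongr
        _ = _ := by field_simp
    -- The outer circle `R = r` gives decay for `k ≥ 0`, the inner one `R = r⁻¹` for `k ≤ 0`.
    rcases le_total 0 k with hk | hk
    · convert! main r ⟨(inv_lt_one_of_one_lt₀ hρ).trans hr, hrρ⟩ using 2
      rw [zpow_neg, ← inv_zpow, ← zpow_natCast, Int.natCast_natAbs, abs_of_nonneg hk]
    · convert! main r⁻¹ ⟨inv_strictAnti₀ hr0 hrρ, (inv_lt_one_of_one_lt₀ hr).trans hρ⟩ using 2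
      rw [← zpow_natCast, Int.natCast_natAbs, abs_of_nonpos hk]
  have hsummable : Summable (fourierCoeff Gc) := by
    refine Summable.of_norm_bounded (g := fun k : ℤ => M * r⁻¹ ^ k.natAbs) ?_ hbound
    refine Summable.mul_left _ ?_
    have hgeo := summable_geometric_of_lt_one (inv_nonneg.2 hr0.le) (inv_lt_one_of_one_lt₀ hr)
    refine Summable.of_nat_of_neg ?_ ?_ <;> simpa using hgeo
  refine ⟨fourierCoeff Gc, hbound, fun x hx => ?_⟩
  have hcos := Real.cos_arccos hx.1 hx.2
  set θ := Real.arccos x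
  have hv : ∀ η : ℝ, Real.cos η = x → Gc (η : AddCircle (2 * Real.pi)) = g x := by
    intro η hη
    rw [hGc, hGdef]
    simp only [joukowski_exp, hη]
  -- Both `θ` and `-θ` lie over `x = cos θ`; averaging the two Fourier series replaces `exp (ikθ)`
  -- by `cos kθ = T_k(x)`.
  have h1 := has_pointwise_sum_fourier_series_of_summable hsummable (θ : AddCircle (2 * Real.pi))
  have h2 := has_pointwise_sum_fourier_series_of_summable hsummable
    ((-θ : ℝ) : AddCircle (2 * Real.pi))
  rw [hv _ hcos] at h1
  rw [hv _ (by rw [Real.cos_neg, hcos])] at h2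
  have h3 := (h1.add h2).mul_left (1 / 2 : ℂ)
  convert! h3 using 1
  · ext k
    rw [← hcos, Polynomial.Chebyshev.T_real_cos, hfou, hfou, Complex.ofReal_cos, Complex.cos]
    push_cast
    simp only [smul_eq_mul]
    ring_nf
  · ring

/-- The Legendre coefficients of a function holomorphic in a Bernstein ellipse decay
geometrically. -/
lemma norm_integral_legendreOrtho_mul_le {ρ r σ M : ℝ} (hσ : 1 < σ) (hσr : σ < r) (hrρ : r < ρ)
    {g : ℂ → ℂ} (hg : DifferentiableOn ℂ g (openEllipse ρ))
    (hM : ∀ w ∈ openEllipse ρ, ‖g w‖ ≤ M) (n : ℕ) :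
    ‖∫ x : ℝ, (legendreOrtho n x : ℂ) * g x ∂uniformSymInterval‖
      ≤ M * √(2 * n + 1) * (∑' k : ℤ, (σ / r) ^ k.natAbs) * σ⁻¹ ^ n := by
  have hσ0 : 0 < σ := by linarith
  have hr0 : 0 < r := by linarith
  have hM0 : 0 ≤ M := (norm_nonneg _).trans
    (hM _ (ofReal_mem_openEllipse (hσ.trans (hσr.trans hrρ)) (x := 0) (by simp)))
  obtain ⟨a, ha, hsum⟩ := exists_hasSum_chebyshev (hσ.trans hσr) hrρ hg hM
  set I : ℤ → ℝ → ℂ := fun k x =>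
    (legendreOrtho n x : ℂ) * ((((Polynomial.Chebyshev.T ℝ k).eval x : ℝ) : ℂ) * a k) with hI
  have hIcont : ∀ k, Continuous (I k) := fun k => by
    have := continuous_legendreOrtho n
    fun_prop
  have hIint : ∀ k, Integrable (I k) uniformSymInterval := fun k =>
    (hIcont k).continuousOn.integrable_uniformSymInterval
  have hIle : ∀ k, ∀ x ∈ Set.Icc (-1 : ℝ) 1, ‖I k x‖ ≤ √(2 * n + 1) * (M * r⁻¹ ^ k.natAbs) := by
    intro k x hx
    rw [hI, norm_mul, norm_mul, Complex.norm_real, Complex.norm_real]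
    have h1 := abs_legendreOrtho_le n hx
    have h2 := Polynomial.Chebyshev.abs_eval_T_real_le_one k (abs_le.2 hx)
    have h3 := ha k
    refine mul_le_mul h1 ?_ (by positivity) (by positivity)
    calc _ ≤ 1 * ‖a k‖ := mul_le_mul_of_nonneg_right h2 (norm_nonneg _)
      _ ≤ _ := by rwa [one_mul]
  have hInorm : ∀ k, ∫ x, ‖I k x‖ ∂uniformSymInterval ≤ √(2 * n + 1) * (M * r⁻¹ ^ k.natAbs) := by
    intro k
    have := integral_mono_ae (hIint k).norm (integrable_const (√(2 * n + 1) * (M * r⁻¹ ^ k.natAbs)))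
      (ae_mem_Icc_uniformSymInterval.mono (hIle k))
    simpa using this
  have hgeo : ∀ q : ℝ, 0 ≤ q → q < 1 → Summable fun k : ℤ => q ^ k.natAbs := by
    intro q h0 h1
    have hgeo := summable_geometric_of_lt_one h0 h1
    refine Summable.of_nat_of_neg ?_ ?_ <;> simpa using hgeo
  have hS : Summable fun k => ∫ x, ‖I k x‖ ∂uniformSymInterval := by
    refine Summable.of_nonneg_of_le (fun k => integral_nonneg fun x => norm_nonneg _) hInorm ?_
    exact ((hgeo _ (inv_nonneg.2 hr0.le)
      (inv_lt_one_of_one_lt₀ (hσ.trans hσr))).mul_left M).mul_left _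
  have hH := hasSum_integral_of_summable_integral_norm hIint hS
  have hEq : ∫ x : ℝ, (legendreOrtho n x : ℂ) * g x ∂uniformSymInterval
      = ∫ x, (∑' k, I k x) ∂uniformSymInterval := by
    refine integral_congr_ae (ae_mem_Icc_uniformSymInterval.mono fun x hx => ?_)
    exact ((hsum x hx).mul_left _).tsum_eq.symm
  rw [hEq]
  have hratio : Summable fun k : ℤ => (σ / r) ^ k.natAbs :=
    hgeo _ (by positivity) ((div_lt_one hr0).2 hσr)
  have hterm : ∀ k, ‖∫ x, I k x ∂uniformSymInterval‖
      ≤ M * √(2 * n + 1) * σ⁻¹ ^ n * (σ / r) ^ k.natAbs := by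
    intro k
    -- Terms with `|k| < n` vanish by orthogonality. In the others, `r^(-|k|)` splits into `σ^(-|k|)
    -- ≤ σ^(-n)` and the factor `(σ/r)^|k|`, summable in `k`.
    rcases lt_or_ge k.natAbs n with hk | hk
    · have : ∫ x, I k x ∂uniformSymInterval = 0 := by
        have h0 := integral_legendreOrtho_mul_eval_eq_zero
          (q := Polynomial.Chebyshev.T ℝ k) (n := n)
          (by rwa [Polynomial.Chebyshev.natDegree_T])
        simp_rw [hI, ← mul_assoc, ← Complex.ofReal_mul]
        rw [integral_mul_const, integral_complex_ofReal, h0]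
        simp
      rw [this, norm_zero]
      positivity
    · refine (norm_integral_le_integral_norm _).trans ((hInorm k).trans ?_)
      have : r⁻¹ ^ k.natAbs = σ⁻¹ ^ k.natAbs * (σ / r) ^ k.natAbs := by
        rw [← mul_pow]; congr 1; field_simp
      rw [this]
      have h1 : σ⁻¹ ^ k.natAbs ≤ σ⁻¹ ^ n :=
        pow_le_pow_of_le_one (by positivity) (inv_le_one_of_one_le₀ hσ.le) hk
      calc _ = M * √(2 * n + 1) * σ⁻¹ ^ k.natAbs * (σ / r) ^ k.natAbs := by ring
        _ ≤ _ := by gcongr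
  rw [← hH.tsum_eq]
  refine (tsum_of_norm_bounded (hratio.hasSum.mul_left _) hterm).trans_eq ?_
  ring

/-! ### Decay of multivariate, Hilbert-valued coefficients -/

lemma pi_openEllipse_subset_interior {d : ℕ} {ρ : Fin d → ℝ} (hρ : ∀ j, 1 < ρ j) :
    (Set.univ.pi fun j => openEllipse (ρ j)) ⊆ interior (bernsteinPolyellipse ρ) :=
  interior_maximal
    (fun _ hz j => openEllipse_subset_bernsteinEllipse (hρ j) (hz j (Set.mem_univ j)))
    (isOpen_set_pi Set.finite_univ fun j _ => isOpen_openEllipse (hρ j))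

lemma ofReal_mem_interior {d : ℕ} {ρ : Fin d → ℝ} (hρ : ∀ j, 1 < ρ j) {y : Fin d → ℝ}
    (hy : y ∈ symCube d) : (fun j => (y j : ℂ)) ∈ interior (bernsteinPolyellipse ρ) :=
  pi_openEllipse_subset_interior hρ fun j _ => ofReal_mem_openEllipse (hρ j) (hy j)

lemma ContinuousOn.comp_ofReal_symCube {d : ℕ} {ρ : Fin d → ℝ} (hρ : ∀ j, 1 < ρ j)
    {E : Type*} [TopologicalSpace E] {F : (Fin d → ℂ) → E}
    (hF : ContinuousOn F (interior (bernsteinPolyellipse ρ))) :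
    ContinuousOn (fun y : Fin d → ℝ => F fun j => (y j : ℂ)) (symCube d) :=
  hF.comp (by fun_prop : Continuous fun (y : Fin d → ℝ) (j : Fin d) => (y j : ℂ)).continuousOn
    fun _ hy => ofReal_mem_interior hρ hy

/-- By continuity, the points of the interior where the bound fails form an open set; if nonempty,
it would have positive measure, against the definition of the essential supremum. -/
lemma norm_le_toReal_polyellipseNorm {d : ℕ} {ρ : Fin d → ℝ} {W : Type*} [NormedAddCommGroup W]
    {F : (Fin d → ℂ) → W} (hF : ContinuousOn F (interior (bernsteinPolyellipse ρ)))
    (hfin : polyellipseNorm ρ F ≠ ∞) {z : Fin d → ℂ}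
    (hz : z ∈ interior (bernsteinPolyellipse ρ)) : ‖F z‖ ≤ (polyellipseNorm ρ F).toReal := by
  by_contra! hlt
  set U := interior (bernsteinPolyellipse ρ) ∩
    F ⁻¹' {w | (polyellipseNorm ρ F).toReal < ‖w‖} with hU
  have hUo : IsOpen U :=
    hF.isOpen_inter_preimage isOpen_interior (isOpen_lt continuous_const continuous_norm)
  refine hUo.measure_ne_zero volume ⟨z, hz, hlt⟩ ?_
  have hae : ∀ᵐ w ∂(volume.restrict (interior (bernsteinPolyellipse ρ))),
      ‖F w‖ₑ ≤ polyellipseNorm ρ F := by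
    refine ae_mono (Measure.restrict_mono_set _ interior_subset) ?_
    rw [polyellipseNorm, eLpNorm_exponent_top]
    exact ae_le_eLpNormEssSup
  rw [ae_restrict_iff' isOpen_interior.measurableSet] at hae
  refine measure_mono_null (fun w hw => ?_) (ae_iff.1 hae)
  intro h
  have h1 := ENNReal.toReal_mono hfin (h hw.1)
  rw [toReal_enorm] at h1
  exact absurd hw.2 (not_lt.2 h1)

lemma tensorLegendre_insertNth {m : ℕ} (j : Fin (m + 1)) (ν : Fin (m + 1) → ℕ) (x : ℝ)
    (y : Fin m → ℝ) : tensorLegendre ν (j.insertNth x y)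
      = tensorLegendre (fun i => ν (j.succAbove i)) y * legendreOrtho (ν j) x := by
  rw [tensorLegendre, Fin.prod_univ_succAbove _ j, mul_comm]
  simp [tensorLegendre]

/-- Bound on tensor Legendre coefficients, using holomorphy in one variable only. -/
lemma norm_integral_tensorLegendre_mul_le {d : ℕ} {ρ : Fin d → ℝ} (hρ : ∀ j, 1 < ρ j)
    {H : (Fin d → ℂ) → ℂ} (hH : DifferentiableOn ℂ H (interior (bernsteinPolyellipse ρ)))
    {M : ℝ} (hM : ∀ z ∈ interior (bernsteinPolyellipse ρ), ‖H z‖ ≤ M)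
    (ν : Fin d → ℕ) (j : Fin d) {r σ : ℝ} (hσ : 1 < σ) (hσr : σ < r) (hrρ : r < ρ j) :
    ‖∫ y, (tensorLegendre ν y : ℂ) * H (fun i => (y i : ℂ)) ∂uniformCube d‖
      ≤ M * (∑' k : ℤ, (σ / r) ^ k.natAbs) * (∏ i, √(2 * ν i + 1)) * σ⁻¹ ^ ν j := by
  obtain ⟨m, rfl⟩ : ∃ m, d = m + 1 := ⟨d - 1, by have := j.isLt; omega⟩
  have hM0 : 0 ≤ M := (norm_nonneg _).trans (hM _ (ofReal_mem_interior hρ (y := 0)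
    (fun _ => by simp)))
  have hK0 : 0 ≤ ∑' k : ℤ, (σ / r) ^ k.natAbs :=
    tsum_nonneg fun k => pow_nonneg (div_nonneg (by linarith) (by linarith)) _
  have hint : Integrable (fun y : Fin (m + 1) → ℝ =>
      (tensorLegendre ν y : ℂ) * H (fun i => (y i : ℂ))) (uniformCube (m + 1)) := by
    refine ContinuousOn.integrable_uniformCube (ContinuousOn.mul ?_ ?_)
    · exact (Complex.continuous_ofReal.comp (continuous_tensorLegendre ν)).continuousOn
    · exact hH.continuousOn.comp_ofReal_symCube hρ
  have hmp := (measurePreserving_piFinSuccAbove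
    (fun _ : Fin (m + 1) => uniformSymInterval) j).symm
  rw [uniformCube_eq_pi] at hint ⊢
  rw [← hmp.integral_comp']
  rw [← hmp.integrable_comp_emb (MeasurableEquiv.measurableEmbedding _)] at hint
  simp only [Function.comp_def] at hint
  rw [integral_prod_symm _ hint]
  refine (norm_integral_le_of_norm_le_const
    (C := M * (∑' k : ℤ, (σ / r) ^ k.natAbs) * (∏ i, √(2 * ν i + 1)) * σ⁻¹ ^ ν j) ?_).trans_eq
    (by simp)
  rw [← uniformCube_eq_pi m]
  filter_upwards [ae_mem_symCube m] with y hy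
  have hinner : ∀ x : ℝ, (tensorLegendre ν ((MeasurableEquiv.piFinSuccAbove
        (fun _ : Fin (m + 1) => ℝ) j).symm (x, y)) : ℂ) *
        H (fun i => (((MeasurableEquiv.piFinSuccAbove
          (fun _ : Fin (m + 1) => ℝ) j).symm (x, y) i : ℝ) : ℂ))
      = (tensorLegendre (fun i => ν (j.succAbove i)) y : ℂ) *
        ((legendreOrtho (ν j) x : ℂ) * H (j.insertNth (x : ℂ) fun i => (y i : ℂ))) := by
    intro x
    have h1 : (MeasurableEquiv.piFinSuccAbove (fun _ : Fin (m + 1) => ℝ) j).symm (x, y)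
        = j.insertNth x y := rfl
    have h2 : (fun i => ((j.insertNth (α := fun _ => ℝ) x y i : ℝ) : ℂ))
        = j.insertNth (α := fun _ => ℂ) (x : ℂ) fun i => (y i : ℂ) := by
      ext i
      refine j.succAboveCases ?_ (fun i => ?_) i <;> simp
    rw [h1, h2, tensorLegendre_insertNth, Complex.ofReal_mul, mul_assoc]
  simp_rw [hinner]
  rw [integral_const_mul, norm_mul, Complex.norm_real, Real.norm_eq_abs]
  -- The other coordinates stay in `[-1,1]`, so the whole complex slice in direction `j` lies in the
  -- interior and the one-variable estimate applies to it.
  have hmaps : ∀ w ∈ openEllipse (ρ j), j.insertNth (α := fun _ => ℂ) w (fun i => (y i : ℂ))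
      ∈ interior (bernsteinPolyellipse ρ) := by
    intro w hw
    refine pi_openEllipse_subset_interior hρ fun i _ => ?_
    refine j.succAboveCases ?_ (fun i => ?_) i
    · simpa using hw
    · simpa using ofReal_mem_openEllipse (hρ _) (hy i)
  have hbd := norm_integral_legendreOrtho_mul_le hσ hσr hrρ
    (g := fun w => H (j.insertNth (α := fun _ => ℂ) w fun i => (y i : ℂ)))
    (hH.comp (Differentiable.differentiableOn (differentiable_pi.2 fun i => by
      refine j.succAboveCases ?_ (fun i => ?_) i <;> simp)) hmaps)
    (fun w hw => hM _ (hmaps w hw)) (ν j)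
  have hb2 := abs_tensorLegendre_le (fun i => ν (j.succAbove i)) hy
  rw [Fin.prod_univ_succAbove _ j]
  calc _ ≤ (∏ i, √(2 * ν (j.succAbove i) + 1)) *
        (M * √(2 * ν j + 1) * (∑' k : ℤ, (σ / r) ^ k.natAbs) * σ⁻¹ ^ ν j) := by gcongr
    _ = _ := by ring

lemma IsHolomorphicExtension.continuousOn {d : ℕ} {ρ : Fin d → ℝ} (hρ : ∀ j, 1 < ρ j)
    {V W : Type*} [NormedAddCommGroup V] [InnerProductSpace ℝ V]
    [NormedAddCommGroup W] [InnerProductSpace ℂ W]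
    {ι : V →ₗᵢ[ℝ] W} {f : (Fin d → ℝ) → V} {F : (Fin d → ℂ) → W}
    (h : IsHolomorphicExtension ι ρ f F) : ContinuousOn f (symCube d) := by
  rw [ι.isometry.isEmbedding.continuousOn_iff]
  exact (h.1.continuousOn.comp_ofReal_symCube hρ).congr fun y hy => (h.2 y hy).symm

/-- The functional `⟨ι c, ·⟩`, with `c` the coefficient itself, reduces to a scalar function bounded
by `‖c‖ M`; its coefficient is `‖c‖²`, and one factor `‖c‖` cancels. -/
lemma norm_legendreCoeff_le {d : ℕ} {ρ : Fin d → ℝ} (hρ : ∀ j, 1 < ρ j)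
    {V W : Type*} [NormedAddCommGroup V] [InnerProductSpace ℝ V] [CompleteSpace V]
    [NormedAddCommGroup W] [InnerProductSpace ℂ W]
    {ι : V →ₗᵢ[ℝ] W} {f : (Fin d → ℝ) → V} {F : (Fin d → ℂ) → W}
    (h : IsHolomorphicExtension ι ρ f F) (hfin : polyellipseNorm ρ F ≠ ∞)
    (ν : Fin d → ℕ) (j : Fin d) {r σ : ℝ} (hσ : 1 < σ) (hσr : σ < r) (hrρ : r < ρ j) :
    ‖legendreCoeff f ν‖ ≤ (polyellipseNorm ρ F).toReal *
      (∑' k : ℤ, (σ / r) ^ k.natAbs) * (∏ i, √(2 * ν i + 1)) * σ⁻¹ ^ ν j := by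
  set c := legendreCoeff f ν with hc
  set M := (polyellipseNorm ρ F).toReal
  rcases eq_or_ne c 0 with h0 | h0
  · rw [h0, norm_zero]
    have hK0 : 0 ≤ ∑' k : ℤ, (σ / r) ^ k.natAbs :=
      tsum_nonneg fun k => pow_nonneg (div_nonneg (by linarith) (by linarith)) _
    have : 0 ≤ M := ENNReal.toReal_nonneg
    positivity
  let L : V →L[ℝ] ℂ :=
    ((innerSL ℂ (ι c)).restrictScalars ℝ).comp ι.toContinuousLinearMap
  have hL : ∀ v, L v = inner ℂ (ι c) (ι v) := fun v => rfl
  have hint : Integrable (fun y => tensorLegendre ν y • f y) (uniformCube d) :=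
    ((continuous_tensorLegendre ν).continuousOn.smul (h.continuousOn hρ)).integrable_uniformCube
  have hLc : L c = ∫ y, (tensorLegendre ν y : ℂ) * inner ℂ (ι c) (F fun i => (y i : ℂ))
      ∂uniformCube d := by
    conv_lhs => rw [hc, legendreCoeff]
    rw [← L.integral_comp_comm hint]
    refine integral_congr_ae ((ae_mem_symCube d).mono fun y hy => ?_)
    simp only [L.map_smul, hL, h.2 y hy, Complex.real_smul]
  have hb := norm_integral_tensorLegendre_mul_le hρ (H := fun z => inner ℂ (ι c) (F z))
    (M := ‖c‖ * M) ((innerSL ℂ (ι c)).differentiable.comp_differentiableOn h.1)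
    (fun z hz => (norm_inner_le_norm _ _).trans (by
      rw [ι.norm_map]
      exact mul_le_mul_of_nonneg_left
        (norm_le_toReal_polyellipseNorm h.1.continuousOn hfin hz) (norm_nonneg _)))
    ν j hσ hσr hrρ
  rw [← hLc, hL, inner_self_eq_norm_sq_to_K, ι.norm_map] at hb
  have h2 : ‖c‖ * ‖c‖ ≤ ‖c‖ * (M * (∑' k : ℤ, (σ / r) ^ k.natAbs) *
      (∏ i, √(2 * ν i + 1)) * σ⁻¹ ^ ν j) := by
    calc ‖c‖ * ‖c‖ = ‖((‖c‖ : ℂ)) ^ 2‖ := by simp [sq]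
      _ ≤ _ := hb
      _ = _ := by ring
  exact le_of_mul_le_mul_left h2 (norm_pos_iff.2 h0)

/-! ### Completeness and convergence of the Legendre series -/

/-- The Legendre polynomials as a polynomial sequence, `legendrePoly n` having degree `n`. -/
noncomputable def legendreSequence : Polynomial.Sequence ℝ where
  elems' := legendrePoly
  degree_eq' n := by
    have h : legendrePoly n ≠ 0 := by
      intro h
      have := coeff_legendrePoly n
      rw [h, Polynomial.coeff_zero] at this
      have h2 : (0 : ℝ) < ((2 * n)! : ℝ) / (2 ^ n * (n ! : ℝ) ^ 2) := by positivity
      exact h2.ne this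
    rw [Polynomial.degree_eq_natDegree h, natDegree_legendrePoly]

lemma exists_eval_eq_sum_legendreOrtho (p : Polynomial ℝ) :
    ∃ (s : Finset ℕ) (l : ℕ → ℝ), ∀ x, p.eval x = ∑ k ∈ s, l k * legendreOrtho k x := by
  have hspan := legendreSequence.span fun i =>
    (isUnit_iff_ne_zero.2 (Polynomial.leadingCoeff_ne_zero.2 (legendreSequence.ne_zero i)))
  have hp : p ∈ Submodule.span ℝ (Set.range fun n => legendreSequence n) := by
    rw [hspan]; trivial
  obtain ⟨l, hl⟩ := Finsupp.mem_span_range_iff_exists_finsupp.1 hp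
  refine ⟨l.support, fun k => l k / √(2 * k + 1), fun x => ?_⟩
  rw [← hl, Finsupp.sum, Polynomial.eval_finsetSum]
  refine Finset.sum_congr rfl fun k _ => ?_
  have h0 : √(2 * (k : ℝ) + 1) ≠ 0 := (Real.sqrt_pos.2 (by positivity)).ne'
  have h1 : (legendreSequence k).eval x = (legendrePoly k).eval x := rfl
  rw [Polynomial.eval_smul, smul_eq_mul, h1, legendreOrtho]
  field_simp

section Completeness

variable {d : ℕ} {E : Type*} [NormedAddCommGroup E] [NormedSpace ℝ E]

lemma integrable_smul_of_continuous {u : (Fin d → ℝ) → E} (hu : Integrable u (uniformCube d))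
    {g : (Fin d → ℝ) → ℝ} (hg : Continuous g) :
    Integrable (fun y => g y • u y) (uniformCube d) := by
  obtain ⟨C, hC⟩ := (isCompact_symCube d).exists_bound_of_continuousOn hg.continuousOn
  exact hu.bdd_smul C hg.aestronglyMeasurable ((ae_mem_symCube d).mono hC)

lemma integral_prod_pow_smul_eq_zero {u : (Fin d → ℝ) → E} (hu : Integrable u (uniformCube d))
    (h : ∀ ν, ∫ y, tensorLegendre ν y • u y ∂uniformCube d = 0) (m : Fin d → ℕ) :
    ∫ y, (∏ j, y j ^ m j) • u y ∂uniformCube d = 0 := by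
  choose s l hl using exists_eval_eq_sum_legendreOrtho
  have hprod : ∀ y : Fin d → ℝ, (∏ j, y j ^ m j)
      = ∑ κ ∈ Fintype.piFinset fun j => s (Polynomial.X ^ m j),
          (∏ j, l (Polynomial.X ^ m j) (κ j)) * tensorLegendre κ y := by
    intro y
    have : ∀ j, y j ^ m j = ∑ k ∈ s (Polynomial.X ^ m j),
        l (Polynomial.X ^ m j) k * legendreOrtho k (y j) := fun j => by
      rw [← hl]; simp
    simp_rw [this, Finset.prod_univ_sum, Finset.prod_mul_distrib, tensorLegendre]
  simp_rw [hprod, Finset.sum_smul, mul_smul]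
  rw [integral_finsetSum]
  · simp [integral_smul, h]
  · exact fun κ _ => (integrable_smul_of_continuous hu (continuous_tensorLegendre κ)).smul
      (∏ j, l (Polynomial.X ^ m j) (κ j))

lemma integral_mvPolynomial_smul_eq_zero {u : (Fin d → ℝ) → E}
    (hu : Integrable u (uniformCube d))
    (h : ∀ ν, ∫ y, tensorLegendre ν y • u y ∂uniformCube d = 0) (p : MvPolynomial (Fin d) ℝ) :
    ∫ y, (MvPolynomial.eval y p) • u y ∂uniformCube d = 0 := by
  simp_rw [MvPolynomial.eval_eq', Finset.sum_smul, mul_smul]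
  rw [integral_finsetSum]
  · simp [integral_smul, integral_prod_pow_smul_eq_zero hu h]
  · exact fun κ _ => (integrable_smul_of_continuous (g := fun y => ∏ i, y i ^ κ i) hu
      (by fun_prop)).smul (p.coeff κ)

/-- Stone–Weierstrass: the coordinate functions already separate points. -/
lemma exists_mvPolynomial_near (g : C(Fin d → ℝ, ℝ)) {ε : ℝ} (hε : 0 < ε) :
    ∃ p : MvPolynomial (Fin d) ℝ, ∀ y ∈ symCube d, |g y - MvPolynomial.eval y p| < ε := by
  let X : Fin d → C(Fin d → ℝ, ℝ) := fun j => ⟨fun y => y j, continuous_apply j⟩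
  have hX : ∀ (p : MvPolynomial (Fin d) ℝ) (y : Fin d → ℝ),
      MvPolynomial.aeval X p y = MvPolynomial.eval y p := by
    intro p y
    induction p using MvPolynomial.induction_on with
    | C a => simp
    | add p q hp hq => simp [hp, hq]
    | mul_X p i hp => simp [hp, X]
  have hsep : (MvPolynomial.aeval (R := ℝ) X).range.SeparatesPoints := by
    intro y z hyz
    obtain ⟨j, hj⟩ := Function.ne_iff.1 hyz
    exact ⟨_, ⟨X j, ⟨MvPolynomial.X j, by simp⟩, rfl⟩, hj⟩
  obtain ⟨_, ⟨p, rfl⟩, hp⟩ :=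
    ContinuousMap.exists_mem_subalgebra_near_continuous_of_isCompact_of_separatesPoints hsep g
      (isCompact_symCube d) hε
  refine ⟨p, fun y hy => ?_⟩
  have := hp y hy
  rw [abs_sub_comm]
  simpa [hX] using this

/-- An integrable function on the cube all of whose Legendre coefficients vanish is zero. -/
lemma ae_eq_zero_of_integral_tensorLegendre_smul [CompleteSpace E] {u : (Fin d → ℝ) → E}
    (hu : Integrable u (uniformCube d))
    (h : ∀ ν, ∫ y, tensorLegendre ν y • u y ∂uniformCube d = 0) :
    ∀ᵐ y ∂uniformCube d, u y = 0 := by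
  refine ae_eq_zero_of_integral_contDiff_smul_eq_zero hu.locallyIntegrable fun g hg _ => ?_
  have hgc := hg.continuous
  rw [← norm_le_zero_iff]
  refine le_of_forall_pos_le_add fun ε hε => ?_
  set I := ∫ y, ‖u y‖ ∂uniformCube d
  have hI : 0 ≤ I := integral_nonneg fun _ => norm_nonneg _
  -- The `+ 1` guards against `I = 0`.
  obtain ⟨p, hp⟩ := exists_mvPolynomial_near (d := d) ⟨g, hgc⟩ (div_pos hε (by linarith : 0 < I + 1))
  have hpc : Continuous fun y => MvPolynomial.eval y p := MvPolynomial.continuous_eval p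
  have hEq : ∫ y, g y • u y ∂uniformCube d
      = ∫ y, (g y - MvPolynomial.eval y p) • u y ∂uniformCube d := by
    simp_rw [sub_smul]
    rw [integral_sub (integrable_smul_of_continuous hu hgc) (integrable_smul_of_continuous hu hpc),
      integral_mvPolynomial_smul_eq_zero hu h, sub_zero]
  rw [hEq]
  calc _ ≤ ∫ y, ε / (I + 1) * ‖u y‖ ∂uniformCube d := by
        refine norm_integral_le_of_norm_le (hu.norm.const_mul _) ?_
        filter_upwards [ae_mem_symCube d] with y hy
        rw [norm_smul]
        exact mul_le_mul_of_nonneg_right (hp y hy).le (norm_nonneg _)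
    _ = ε * (I / (I + 1)) := by rw [integral_const_mul]; ring
    _ ≤ 0 + ε := by
        rw [zero_add]
        exact mul_le_of_le_one_right hε.le ((div_le_one (by linarith)).2 (by linarith))

lemma eLpNorm_tensorLegendre_le (ν : Fin d → ℕ) :
    eLpNorm (tensorLegendre ν) ∞ (uniformCube d) ≤ ENNReal.ofReal (∏ j, √(2 * ν j + 1)) := by
  rw [eLpNorm_exponent_top]
  refine eLpNormEssSup_le_of_ae_bound ?_
  filter_upwards [ae_mem_symCube d] with y hy
  exact abs_tensorLegendre_le ν hy

lemma eLpNorm_tensorLegendre_ne_top (ν : Fin d → ℕ) :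
    eLpNorm (tensorLegendre ν) ∞ (uniformCube d) ≠ ∞ :=
  ((eLpNorm_tensorLegendre_le ν).trans_lt ENNReal.ofReal_lt_top).ne

lemma ae_enorm_tensorLegendre_le :
    ∀ᵐ y ∂uniformCube d, ∀ ν : Fin d → ℕ,
      ‖tensorLegendre ν y‖ₑ ≤ eLpNorm (tensorLegendre ν) ∞ (uniformCube d) := by
  rw [ae_all_iff]
  intro ν
  rw [eLpNorm_exponent_top]
  exact ae_le_eLpNormEssSup

/-- A function whose Legendre series is absolutely summable in `L^∞` is the sum of that series. -/
lemma ae_hasSum_legendre [CompleteSpace E] {f : (Fin d → ℝ) → E}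
    (hf : Integrable f (uniformCube d))
    (hs : Summable fun ν : Fin d → ℕ =>
      (eLpNorm (tensorLegendre ν) ∞ (uniformCube d)).toReal * ‖legendreCoeff f ν‖) :
    ∀ᵐ y ∂uniformCube d, HasSum (fun ν => tensorLegendre ν y • legendreCoeff f ν) (f y) := by
  set B : (Fin d → ℕ) → ℝ := fun ν => (eLpNorm (tensorLegendre ν) ∞ (uniformCube d)).toReal
    with hB
  have hae : ∀ᵐ y ∂uniformCube d, ∀ ν : Fin d → ℕ, ‖tensorLegendre ν y‖ ≤ B ν := by
    filter_upwards [ae_enorm_tensorLegendre_le (d := d)] with y hy ν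
    rw [← toReal_enorm]
    exact ENNReal.toReal_mono (eLpNorm_tensorLegendre_ne_top ν) (hy ν)
  have hsum : ∀ᵐ y ∂uniformCube d,
      Summable fun ν => tensorLegendre ν y • legendreCoeff f ν := by
    filter_upwards [hae] with y hy
    refine Summable.of_norm_bounded hs fun ν => ?_
    rw [norm_smul]
    exact mul_le_mul_of_nonneg_right (hy ν) (norm_nonneg _)
  -- The series converges only almost everywhere; elsewhere `tsum` may take its default value `0`,
  -- which is harmless.
  set g : (Fin d → ℝ) → E := fun y => ∑' ν, tensorLegendre ν y • legendreCoeff f ν with hg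
  have hterm : ∀ (c : E) {a : (Fin d → ℝ) → ℝ}, Continuous a →
      Integrable (fun y => a y • c) (uniformCube d) := fun c a ha =>
    (ha.smul continuous_const).continuousOn.integrable_uniformCube
  have hgint : Integrable g (uniformCube d) := by
    have hmeas : AEStronglyMeasurable g (uniformCube d) := by
      refine aestronglyMeasurable_of_tendsto_ae (Filter.atTop : Filter (Finset (Fin d → ℕ)))
        (f := fun s y => ∑ ν ∈ s, tensorLegendre ν y • legendreCoeff f ν) (fun s => ?_) ?_
      · exact (integrable_finsetSum _ fun ν _ =>
          hterm _ (continuous_tensorLegendre ν)).aestronglyMeasurable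
      · filter_upwards [hsum] with y hy using hy.hasSum
    refine Integrable.of_bound hmeas (∑' ν, B ν * ‖legendreCoeff f ν‖) ?_
    filter_upwards [hae] with y hy
    refine tsum_of_norm_bounded hs.hasSum fun ν => ?_
    rw [norm_smul]
    exact mul_le_mul_of_nonneg_right (hy ν) (norm_nonneg _)
  have hcoef : ∀ μ, ∫ y, tensorLegendre μ y • g y ∂uniformCube d = legendreCoeff f μ := by
    intro μ
    set I : (Fin d → ℕ) → (Fin d → ℝ) → E := fun ν y =>
      (tensorLegendre μ y * tensorLegendre ν y) • legendreCoeff f ν with hI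
    have hIint : ∀ ν, Integrable (I ν) (uniformCube d) := fun ν =>
      hterm _ ((continuous_tensorLegendre μ).mul (continuous_tensorLegendre ν))
    have hIsum : Summable fun ν => ∫ y, ‖I ν y‖ ∂uniformCube d := by
      refine Summable.of_nonneg_of_le (fun ν => integral_nonneg fun _ => norm_nonneg _)
        (fun ν => ?_) (hs.mul_left (B μ))
      have := integral_mono_ae (hIint ν).norm
        (integrable_const (B μ * (B ν * ‖legendreCoeff f ν‖))) (by
          filter_upwards [hae] with y hy
          rw [hI, norm_smul, norm_mul, mul_assoc]
          have := hy μ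
          have := hy ν
          gcongr)
      rwa [integral_const, probReal_univ, one_smul] at this
    have hH := hasSum_integral_of_summable_integral_norm hIint hIsum
    have hEq : ∫ y, tensorLegendre μ y • g y ∂uniformCube d
        = ∫ y, ∑' ν, I ν y ∂uniformCube d := by
      refine integral_congr_ae ?_
      filter_upwards [hsum] with y hy
      simp only [hg, hI, mul_smul]
      exact (hy.tsum_const_smul _).symm
    rw [hEq, ← hH.tsum_eq]
    simp only [hI, integral_smul_const, integral_tensorLegendre_mul]
    rw [tsum_eq_single μ]
    · simp
    · intro ν hν
      simp [hν.symm]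
  -- `f - g` is integrable with all Legendre coefficients zero.
  have hzero := ae_eq_zero_of_integral_tensorLegendre_smul (hf.sub hgint) fun μ => by
    simp only [Pi.sub_apply, smul_sub]
    rw [integral_sub (integrable_smul_of_continuous hf (continuous_tensorLegendre μ))
      (integrable_smul_of_continuous hgint (continuous_tensorLegendre μ)), hcoef]
    exact sub_self _
  filter_upwards [hzero, hsum] with y hy hy2
  rw [sub_eq_zero.1 hy]
  exact hy2.hasSum

/-- An infinite right-hand side is trivial. A finite one, with the finitely many terms in `S`, makes
the full series summable, so the error is almost everywhere the sum of the terms outside `S`. -/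
lemma eLpNorm_top_sub_legendreTrunc_le [CompleteSpace E] {f : (Fin d → ℝ) → E}
    (hf : Integrable f (uniformCube d)) (S : Finset (Fin d → ℕ)) :
    eLpNorm (fun y => f y - legendreTrunc f S y) ∞ (uniformCube d)
      ≤ ∑' ν : {ν : Fin d → ℕ // ν ∉ S},
          eLpNorm (tensorLegendre ν.1) ∞ (uniformCube d) * ‖legendreCoeff f ν.1‖ₑ := by
  rcases eq_or_ne (∑' ν : {ν : Fin d → ℕ // ν ∉ S},
    eLpNorm (tensorLegendre ν.1) ∞ (uniformCube d) * ‖legendreCoeff f ν.1‖ₑ) ∞ with htop | htop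
  · rw [htop]; exact le_top
  have hs : Summable fun ν : Fin d → ℕ =>
      (eLpNorm (tensorLegendre ν) ∞ (uniformCube d)).toReal * ‖legendreCoeff f ν‖ := by
    rw [← Finset.summable_compl_iff S]
    convert! ENNReal.summable_toReal htop using 2 with ν
    simp
  rw [eLpNorm_exponent_top]
  refine eLpNormEssSup_le_of_ae_enorm_bound ?_
  filter_upwards [ae_hasSum_legendre hf hs, ae_enorm_tensorLegendre_le (d := d)] with y hy hB
  have : f y - legendreTrunc f S y
      = ∑' ν : {ν : Fin d → ℕ // ν ∉ S}, tensorLegendre ν.1 y • legendreCoeff f ν.1 := by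
    rw [← hy.tsum_eq, legendreTrunc, sub_eq_iff_eq_add']
    exact (hy.summable.sum_add_tsum_subtype_compl S).symm
  rw [this]
  refine enorm_tsum_le_tsum_enorm.trans (ENNReal.tsum_le_tsum fun ν => ?_)
  rw [enorm_smul]
  gcongr
  exact hB ν.1

end Completeness

/-! ### Summable coefficient bounds outside boxes -/

/-- Any finite set of multi-indices lies in a product of finite sets, where the sum factorises. -/
lemma summable_prod_pi {d : ℕ} {a : Fin d → ℕ → ℝ} (h0 : ∀ j k, 0 ≤ a j k)
    (ha : ∀ j, Summable (a j)) : Summable fun ν : Fin d → ℕ => ∏ j, a j (ν j) := by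
  refine summable_of_sum_le (c := ∏ j, ∑' k, a j k)
    (fun ν => Finset.prod_nonneg fun j _ => h0 j _) fun u => ?_
  calc ∑ ν ∈ u, ∏ j, a j (ν j)
      ≤ ∑ ν ∈ Fintype.piFinset fun j => u.image (· j), ∏ j, a j (ν j) := by
        refine Finset.sum_le_sum_of_subset_of_nonneg (fun ν hν => ?_)
          fun ν _ _ => Finset.prod_nonneg fun j _ => h0 j _
        exact Fintype.mem_piFinset.2 fun j => Finset.mem_image_of_mem (· j) hν
    _ = ∏ j, ∑ k ∈ u.image (· j), a j k := (Finset.prod_univ_sum _ _).symm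
    _ ≤ ∏ j, ∑' k, a j k :=
        Finset.prod_le_prod (fun j _ => Finset.sum_nonneg fun k _ => h0 j k)
          fun j _ => (ha j).sum_le_tsum _ fun k _ => h0 j k

lemma summable_two_mul_add_one_mul_pow {q : ℝ} (h0 : 0 ≤ q) (h1 : q < 1) :
    Summable fun k : ℕ => (2 * (k : ℝ) + 1) * q ^ k := by
  have hq : ‖q‖ < 1 := by rwa [Real.norm_of_nonneg h0]
  have h := ((summable_pow_mul_geometric_of_norm_lt_one 1 hq).mul_left 2).add
    (summable_geometric_of_lt_one h0 h1)
  refine h.congr fun k => ?_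
  ring

/-- Legendre coefficients outside a box `{ν | ∀ j, ν j * log (ρ j) ≤ t}` are of order
`exp (-α t)`, up to a summable factor, for each `α < 1`. -/
lemma exists_summable_legendreCoeff_bound {d : ℕ} {ρ : Fin d → ℝ} (hρ : ∀ j, 1 < ρ j)
    {α : ℝ} (hα0 : 0 < α) (hα1 : α < 1) :
    ∃ b : (Fin d → ℕ) → ℝ, Summable b ∧ (∀ ν, 0 ≤ b ν) ∧
      ∀ (V : Type u) [NormedAddCommGroup V] [InnerProductSpace ℝ V] [CompleteSpace V]
        (W : Type v) [NormedAddCommGroup W] [InnerProductSpace ℂ W]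
        (ι : V →ₗᵢ[ℝ] W) (f : (Fin d → ℝ) → V) (F : (Fin d → ℂ) → W),
        IsHolomorphicExtension ι ρ f F → polyellipseNorm ρ F ≠ ∞ →
        ∀ (ν : Fin d → ℕ) (t : ℝ), (∃ j, t < ν j * Real.log (ρ j)) →
          (∏ j, √(2 * ν j + 1)) * ‖legendreCoeff f ν‖
            ≤ (polyellipseNorm ρ F).toReal * Real.exp (-(α * t)) * b ν := by
  -- With `α < θ < τ < 1`, take `σ_j = ρ_j^θ` and `r_j = ρ_j^τ`. The decay at rate `θ` is later
  -- split: `α` pays for `exp (-α t)`, and `θ - α` for summability.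
  obtain ⟨θ, hαθ, hθ1⟩ := exists_between hα1
  obtain ⟨τ, hθτ, hτ1⟩ := exists_between hθ1
  have hL : ∀ j, 0 < Real.log (ρ j) := fun j => Real.log_pos (hρ j)
  set σ : Fin d → ℝ := fun j => Real.exp (θ * Real.log (ρ j)) with hσdef
  set r : Fin d → ℝ := fun j => Real.exp (τ * Real.log (ρ j)) with hrdef
  have hσ : ∀ j, 1 < σ j := fun j =>
    Real.one_lt_exp_iff.2 (mul_pos (hα0.trans hαθ) (hL j))
  have hσr : ∀ j, σ j < r j := fun j =>
    Real.exp_lt_exp.2 (mul_lt_mul_of_pos_right hθτ (hL j))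
  have hrρ : ∀ j, r j < ρ j := fun j => by
    calc r j < Real.exp (1 * Real.log (ρ j)) :=
          Real.exp_lt_exp.2 (mul_lt_mul_of_pos_right hτ1 (hL j))
      _ = ρ j := by rw [one_mul, Real.exp_log (by linarith [hρ j])]
  set K : Fin d → ℝ := fun j => ∑' k : ℤ, (σ j / r j) ^ k.natAbs with hK
  have hK0 : ∀ j, 0 ≤ K j := fun j => tsum_nonneg fun k =>
    pow_nonneg (div_nonneg (Real.exp_pos _).le (Real.exp_pos _).le) _
  -- The surplus `θ - α` is shared equally among the `d` coordinates, since the maximum of the `ν_i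
  -- log ρ_i` is at least their average.
  set q : Fin d → ℝ := fun j => Real.exp (-((θ - α) / d * Real.log (ρ j))) with hq
  refine ⟨fun ν => (∑ j, K j) * ∏ j, ((2 * (ν j : ℝ) + 1) * q j ^ ν j), ?_, ?_, ?_⟩
  · refine Summable.mul_left _ (summable_prod_pi
      (a := fun j k => (2 * (k : ℝ) + 1) * q j ^ k) (fun j k => by positivity) fun j => ?_)
    refine summable_two_mul_add_one_mul_pow (Real.exp_pos _).le (Real.exp_lt_one_iff.2 ?_)
    have hd : 0 < (d : ℝ) := by exact_mod_cast j.pos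
    have := hL j
    have : 0 < θ - α := by linarith
    rw [neg_lt_zero]
    positivity
  · intro ν
    have := Finset.sum_nonneg fun j (_ : j ∈ Finset.univ) => hK0 j
    positivity
  intro V _ _ _ W _ _ ι f F hF hfin ν t ⟨j₀, hj₀⟩
  have : Nonempty (Fin d) := ⟨j₀⟩
  obtain ⟨j, hj⟩ := Finite.exists_max fun j => (ν j : ℝ) * Real.log (ρ j)
  have hd : 0 < (d : ℝ) := by exact_mod_cast j.pos
  set m := (ν j : ℝ) * Real.log (ρ j) with hm
  have htm : t ≤ m := hj₀.le.trans (hj j₀)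
  have hc := norm_legendreCoeff_le hρ hF hfin ν j (hσ j) (hσr j) (hrρ j)
  set N := (polyellipseNorm ρ F).toReal
  have hN : 0 ≤ N := ENNReal.toReal_nonneg
  have hsq : (∏ i, √(2 * (ν i : ℝ) + 1)) * (∏ i, √(2 * (ν i : ℝ) + 1))
      = ∏ i, (2 * (ν i : ℝ) + 1) := by
    rw [← Finset.prod_mul_distrib]
    exact Finset.prod_congr rfl fun i _ => Real.mul_self_sqrt (by positivity)
  have hexp : (σ j)⁻¹ ^ ν j ≤ Real.exp (-(α * t)) * ∏ i, q i ^ ν i := by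
    have h1 : (σ j)⁻¹ ^ ν j = Real.exp (-(θ * m)) := by
      rw [hσdef, ← Real.exp_neg, ← Real.exp_nat_mul, hm]
      ring_nf
    have h2 : ∏ i, q i ^ ν i
        = Real.exp (-((θ - α) / d * ∑ i, (ν i : ℝ) * Real.log (ρ i))) := by
      simp_rw [hq, ← Real.exp_nat_mul]
      rw [← Real.exp_sum, Finset.mul_sum, ← Finset.sum_neg_distrib]
      congr 1
      exact Finset.sum_congr rfl fun i _ => by ring
    rw [h1, h2, ← Real.exp_add, Real.exp_le_exp]
    have h3 : ∑ i, (ν i : ℝ) * Real.log (ρ i) ≤ d * m := by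
      calc _ ≤ ∑ _i : Fin d, m := Finset.sum_le_sum fun i _ => hj i
        _ = d * m := by simp
    have h4 : (θ - α) / d * ∑ i, (ν i : ℝ) * Real.log (ρ i) ≤ (θ - α) * m := by
      calc _ ≤ (θ - α) / d * (d * m) :=
            mul_le_mul_of_nonneg_left h3 (div_nonneg (by linarith) hd.le)
        _ = (θ - α) * m := by field_simp
    have h5 : α * t ≤ α * m := mul_le_mul_of_nonneg_left htm hα0.le
    linarith
  have hKj : K j ≤ ∑ i, K i := Finset.single_le_sum (fun i _ => hK0 i) (Finset.mem_univ j)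
  calc (∏ i, √(2 * (ν i : ℝ) + 1)) * ‖legendreCoeff f ν‖
      ≤ (∏ i, √(2 * (ν i : ℝ) + 1)) *
          (N * K j * (∏ i, √(2 * (ν i : ℝ) + 1)) * (σ j)⁻¹ ^ ν j) := by gcongr
    _ = N * K j * (∏ i, (2 * (ν i : ℝ) + 1)) * (σ j)⁻¹ ^ ν j := by rw [← hsq]; ring
    _ ≤ N * (∑ i, K i) * (∏ i, (2 * (ν i : ℝ) + 1)) *
          (Real.exp (-(α * t)) * ∏ i, q i ^ ν i) := by
        have hσ0 : 0 ≤ (σ j)⁻¹ := inv_nonneg.2 (Real.exp_pos _).le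
        have hKs : 0 ≤ ∑ i, K i := (hK0 j).trans hKj
        gcongr
    _ = _ := by simp only [Finset.prod_mul_distrib]; ring

/-! ### Index boxes: counting and choice of the threshold -/

/-- The box `{ν | ∀ j, ν j * L j ≤ t}` of multi-indices. -/
noncomputable def indexBox {d : ℕ} (L : Fin d → ℝ) (t : ℝ) : Finset (Fin d → ℕ) :=
  Fintype.piFinset fun j => Finset.range (⌊t / L j⌋₊ + 1)

lemma isLowerSet_indexBox {d : ℕ} (L : Fin d → ℝ) (t : ℝ) :
    IsLowerSet (indexBox L t : Set (Fin d → ℕ)) := by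
  intro ν μ hμν hν
  simp only [indexBox, Finset.mem_coe, Fintype.mem_piFinset, Finset.mem_range] at hν ⊢
  exact fun j => (hμν j).trans_lt (hν j)

lemma exists_lt_of_notMem_indexBox {d : ℕ} {L : Fin d → ℝ} (hL : ∀ j, 0 < L j) {t : ℝ}
    {ν : Fin d → ℕ} (hν : ν ∉ indexBox L t) : ∃ j, t < ν j * L j := by
  simp only [indexBox, Fintype.mem_piFinset, Finset.mem_range, not_forall, not_lt] at hν
  obtain ⟨j, hj⟩ := hν
  exact ⟨j, (div_lt_iff₀ (hL j)).1 (Nat.lt_of_floor_lt (Nat.lt_of_succ_le hj))⟩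

/-- Each side contributes `(⌊t / L_j⌋ + 1) L_j ≤ t + L_j`. The cruder `t + ∑ L_j` makes all factors
equal, so `t` can be solved for. -/
lemma card_indexBox_mul_prod_le {d : ℕ} {L : Fin d → ℝ} (hL : ∀ j, 0 < L j) {t : ℝ}
    (ht : 0 ≤ t) : ((indexBox L t).card : ℝ) * ∏ j, L j ≤ (t + ∑ j, L j) ^ d := by
  rw [indexBox, Fintype.card_piFinset]
  push_cast
  rw [← Finset.prod_mul_distrib]
  calc _ ≤ ∏ _j : Fin d, (t + ∑ j, L j) := by
        refine Finset.prod_le_prod (fun j _ => mul_nonneg (by positivity) (hL j).le) fun j _ => ?_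
        have h1 : (⌊t / L j⌋₊ : ℝ) ≤ t / L j := Nat.floor_le (div_nonneg ht (hL j).le)
        have h2 : L j ≤ ∑ j, L j :=
          Finset.single_le_sum (fun i _ => (hL i).le) (Finset.mem_univ j)
        rw [Finset.card_range]
        push_cast
        calc ((⌊t / L j⌋₊ : ℝ) + 1) * L j ≤ (t / L j + 1) * L j :=
              mul_le_mul_of_nonneg_right (by linarith) (hL j).le
          _ = t + L j := by have := (hL j).ne'; field_simp
          _ ≤ _ := by linarith
    _ = _ := by simp

lemma exp_le_expRate {d : ℕ} (hd : 1 ≤ d) {ρ : Fin d → ℝ} (hρ : ∀ j, 1 < ρ j) {ε : ℝ}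
    (hε : 0 < ε) (s : ℕ) :
    Real.exp (-((d : ℝ) / (d + 1) * ((s : ℝ) * ∏ j, Real.log (ρ j)) ^ (1 / (d : ℝ))))
      ≤ expRate ρ ε s := by
  have hP : 0 ≤ ∏ j, Real.log (ρ j) := Finset.prod_nonneg fun j _ => (Real.log_pos (hρ j)).le
  have hd0 : (d : ℝ) ≠ 0 := by positivity
  have key : (((s : ℝ) * (d ! : ℝ) * (∏ j, Real.log (ρ j))) / (1 + ε)) ^ (1 / (d : ℝ))
      ≤ d * ((s : ℝ) * ∏ j, Real.log (ρ j)) ^ (1 / (d : ℝ)) := by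
    have h1 : (d : ℝ) = ((d : ℝ) ^ d) ^ (1 / (d : ℝ)) := by
      rw [one_div, Real.pow_rpow_inv_natCast (by positivity) (by omega)]
    have h3 : d * ((s : ℝ) * ∏ j, Real.log (ρ j)) ^ (1 / (d : ℝ))
        = ((d : ℝ) ^ d * ((s : ℝ) * ∏ j, Real.log (ρ j))) ^ (1 / (d : ℝ)) := by
      rw [Real.mul_rpow (x := (d : ℝ) ^ d) (by positivity) (by positivity), ← h1]
    rw [h3]
    refine Real.rpow_le_rpow (by positivity) ?_ (by positivity)
    have h2 : (d ! : ℝ) ≤ (d : ℝ) ^ d := by exact_mod_cast Nat.factorial_le_pow d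
    calc _ ≤ ((s : ℝ) * (d ! : ℝ) * (∏ j, Real.log (ρ j))) :=
          div_le_self (by positivity) (by linarith)
      _ ≤ (s : ℝ) * (d : ℝ) ^ d * (∏ j, Real.log (ρ j)) := by gcongr
      _ = _ := by ring
  rw [expRate, Real.exp_le_exp, neg_mul, neg_le_neg_iff]
  calc _ ≤ 1 / ((d : ℝ) + 1) * (d * ((s : ℝ) * ∏ j, Real.log (ρ j)) ^ (1 / (d : ℝ))) := by gcongr
    _ = _ := by ring

/-- For large `s` there is a threshold `t` whose index box has at most `s` elements and for which
`C * exp (-α t)` is below the required rate. -/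
lemma exists_forall_exists_indexBox {d : ℕ} (hd : 1 ≤ d) {ρ : Fin d → ℝ} (hρ : ∀ j, 1 < ρ j)
    {ε : ℝ} (hε : 0 < ε) {α : ℝ} (hα : (d : ℝ) / (d + 1) < α) (C : ℝ) :
    ∃ sbar : ℕ, ∀ s ≥ sbar, ∃ t : ℝ,
      (indexBox (fun j => Real.log (ρ j)) t).card ≤ s ∧
        Real.exp (-(α * t)) * C ≤ expRate ρ ε s := by
  have hL : ∀ j, 0 < Real.log (ρ j) := fun j => Real.log_pos (hρ j)
  set P := ∏ j, Real.log (ρ j) with hP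
  have hP0 : 0 < P := Finset.prod_pos fun j _ => hL j
  set A := ∑ j, Real.log (ρ j) with hA
  set R : ℕ → ℝ := fun s => ((s : ℝ) * P) ^ (1 / (d : ℝ)) with hR
  have hRtop : Filter.Tendsto R Filter.atTop Filter.atTop :=
    (tendsto_rpow_atTop (by positivity)).comp
      (tendsto_natCast_atTop_atTop.atTop_mul_const hP0)
  have hEtop : Filter.Tendsto (fun s => Real.exp ((α - d / (d + 1)) * R s))
      Filter.atTop Filter.atTop :=
    Real.tendsto_exp_atTop.comp (hRtop.const_mul_atTop (by linarith))
  -- The first condition makes `t = R s - A` nonnegative; the second lets the gap `α - d/(d+1)`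
  -- absorb `C` and the loss `exp (α A)` from the shift by `A`.
  obtain ⟨sbar, hs⟩ := Filter.eventually_atTop.1
    ((hRtop.eventually_ge_atTop A).and (hEtop.eventually_ge_atTop (Real.exp (α * A) * C)))
  -- With this `t`, the counting bound `(t + A) ^ d` equals `s P` exactly.
  refine ⟨sbar, fun s hsbar => ⟨R s - A, ?_, ?_⟩⟩
  · have h := card_indexBox_mul_prod_le hL (t := R s - A) (by linarith [(hs s hsbar).1])
    have hRd : R s ^ d = s * P := by
      simp only [hR, one_div]
      exact Real.rpow_inv_natCast_pow (by positivity) (by omega)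
    rw [← hA, sub_add_cancel, hRd] at h
    exact_mod_cast le_of_mul_le_mul_right h hP0
  · refine le_trans ?_ (exp_le_expRate hd hρ hε s)
    have h := (hs s hsbar).2
    calc Real.exp (-(α * (R s - A))) * C
        = Real.exp (-(α * R s)) * (Real.exp (α * A) * C) := by
          rw [← mul_assoc, ← Real.exp_add]; ring_nf
      _ ≤ Real.exp (-(α * R s)) * Real.exp ((α - d / (d + 1)) * R s) := by gcongr
      _ = Real.exp (-((d : ℝ) / (d + 1) * R s)) := by rw [← Real.exp_add]; ring_nf

/-! ### Assembly of the theorem -/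

lemma one_le_prod_sqrt {d : ℕ} (ν : Fin d → ℕ) : 1 ≤ ∏ j, √(2 * (ν j : ℝ) + 1) :=
  Finset.one_le_prod fun j _ => Real.one_le_sqrt.2 (by linarith [(ν j).cast_nonneg (α := ℝ)])

lemma ell1Norm_sub_seqTrunc {I V : Type*} [DecidableEq I] [NormedAddCommGroup V] (c : I → V)
    (S : Finset I) :
    ell1Norm (fun ν => c ν - seqTrunc c S ν) = ∑' ν : {ν : I // ν ∉ S}, ‖c ν.1‖ₑ := by
  have h : Function.support (fun ν => ‖c ν - seqTrunc c S ν‖ₑ) ⊆ {ν | ν ∉ S} := by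
    intro ν hν hS
    simp [seqTrunc, hS] at hν
  rw [ell1Norm, ← tsum_subtype_eq_of_support_subset h]
  exact tsum_congr fun ν => by simp [seqTrunc, show ν.1 ∉ S from ν.2]

theorem theorem2 (d : ℕ) (hd : 1 ≤ d) (ρ : Fin d → ℝ) (hρ : ∀ j, 1 < ρ j)
    (ε : ℝ) (hε : 0 < ε) :
    ∃ sbar : ℕ,
      ∀ (V : Type u) [NormedAddCommGroup V] [InnerProductSpace ℝ V] [CompleteSpace V]
        [TopologicalSpace.SeparableSpace V]
        (W : Type v) [NormedAddCommGroup W] [InnerProductSpace ℂ W] [CompleteSpace W]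
        (ι : V →ₗᵢ[ℝ] W) (f : (Fin d → ℝ) → V) (F : (Fin d → ℂ) → W),
        IsHolomorphicExtension ι ρ f F →
        ∀ s : ℕ, sbar ≤ s →
          ∃ S : Finset (Fin d → ℕ),
            IsLowerSet (S : Set (Fin d → ℕ)) ∧ S.card ≤ s ∧
            eLpNorm (fun y => f y - legendreTrunc f S y) 2 (uniformCube d)
              ≤ eLpNorm (fun y => f y - legendreTrunc f S y) ∞ (uniformCube d) ∧
            eLpNorm (fun y => f y - legendreTrunc f S y) ∞ (uniformCube d)
              ≤ ∑' ν : {ν : Fin d → ℕ // ν ∉ S},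
                  eLpNorm (tensorLegendre ν.1) ∞ (uniformCube d) * ‖legendreCoeff f ν.1‖ₑ ∧
            ∑' ν : {ν : Fin d → ℕ // ν ∉ S},
                eLpNorm (tensorLegendre ν.1) ∞ (uniformCube d) * ‖legendreCoeff f ν.1‖ₑ
              ≤ polyellipseNorm ρ F * ENNReal.ofReal (expRate ρ ε s) ∧
            ell1Norm (fun ν => legendreCoeff f ν - seqTrunc (legendreCoeff f) S ν)
              ≤ polyellipseNorm ρ F * ENNReal.ofReal (expRate ρ ε s) := by
  have hd0 : (0 : ℝ) < d := by exact_mod_cast hd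
  obtain ⟨α, hα, hα1⟩ := exists_between
    (show (d : ℝ) / (d + 1) < 1 from (div_lt_one (by positivity)).2 (by linarith))
  have hα0 : 0 < α := lt_trans (by positivity) hα
  -- `b` is fixed before `V`, `W`, `f` and `F`, so `sbar` is uniform in them.
  obtain ⟨b, hb, hb0, hbound⟩ := exists_summable_legendreCoeff_bound.{u, v} hρ hα0 hα1
  obtain ⟨sbar, hsbar⟩ := exists_forall_exists_indexBox hd hρ hε hα (∑' ν, b ν)
  refine ⟨sbar, fun V _ _ _ _ W _ _ _ ι f F hF s hs => ?_⟩
  obtain ⟨t, hcard, hrate⟩ := hsbar s hs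
  set S := indexBox (fun j => Real.log (ρ j)) t
  have hfc : ContinuousOn f (symCube d) := hF.continuousOn hρ
  -- One tail serves both final bounds: the weight dominates `‖Ψ_ν‖_∞` and is at least `1`, so it
  -- also controls the unweighted coefficient sum.
  have htail : ∑' ν : {ν : Fin d → ℕ // ν ∉ S},
      ENNReal.ofReal ((∏ j, √(2 * (ν.1 j : ℝ) + 1)) * ‖legendreCoeff f ν.1‖)
        ≤ polyellipseNorm ρ F * ENNReal.ofReal (expRate ρ ε s) := by
    rcases eq_or_ne (polyellipseNorm ρ F) ∞ with htop | hfin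
    · have hpos : 0 < expRate ρ ε s := Real.exp_pos _
      rw [htop, ENNReal.top_mul (ENNReal.ofReal_pos.2 hpos).ne']
      exact le_top
    set N := (polyellipseNorm ρ F).toReal with hN
    have hN0 : 0 ≤ N := ENNReal.toReal_nonneg
    have hbS : Summable fun ν : {ν : Fin d → ℕ // ν ∉ S} => b ν.1 :=
      hb.comp_injective Subtype.val_injective
    calc _ ≤ ∑' ν : {ν : Fin d → ℕ // ν ∉ S},
          ENNReal.ofReal (N * Real.exp (-(α * t)) * b ν.1) :=
          ENNReal.tsum_le_tsum fun ν => ENNReal.ofReal_le_ofReal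
            (hbound V W ι f F hF hfin ν.1 t
              (exists_lt_of_notMem_indexBox (fun j => Real.log_pos (hρ j)) ν.2))
      _ = ENNReal.ofReal (N * Real.exp (-(α * t)) * ∑' ν : {ν : Fin d → ℕ // ν ∉ S}, b ν.1) := by
          rw [← tsum_mul_left, ENNReal.ofReal_tsum_of_nonneg _ (hbS.mul_left _)]
          exact fun ν => mul_nonneg (mul_nonneg hN0 (Real.exp_pos _).le) (hb0 _)
      _ ≤ ENNReal.ofReal (N * expRate ρ ε s) := by
          refine ENNReal.ofReal_le_ofReal ?_
          rw [mul_assoc]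
          refine mul_le_mul_of_nonneg_left (le_trans ?_ hrate) hN0
          exact mul_le_mul_of_nonneg_left
            (hbS.tsum_le_tsum_of_inj Subtype.val Subtype.val_injective (fun ν _ => hb0 ν)
              (fun _ => le_rfl) hb) (Real.exp_pos _).le
      _ = _ := by rw [ENNReal.ofReal_mul hN0, hN, ENNReal.ofReal_toReal hfin]
  refine ⟨S, isLowerSet_indexBox _ _, hcard, ?_, ?_, ?_, ?_⟩
  · refine eLpNorm_le_eLpNorm_of_exponent_le le_top ?_
    refine (hfc.sub (Continuous.continuousOn ?_)).aestronglyMeasurable_uniformCube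
    exact continuous_finsetSum _ fun ν _ => (continuous_tensorLegendre ν).smul continuous_const
  · exact eLpNorm_top_sub_legendreTrunc_le hfc.integrable_uniformCube S
  · refine le_trans (ENNReal.tsum_le_tsum fun ν => ?_) htail
    rw [ENNReal.ofReal_mul (zero_le_one.trans (one_le_prod_sqrt _)), ofReal_norm]
    gcongr
    exact eLpNorm_tensorLegendre_le ν.1
  · rw [ell1Norm_sub_seqTrunc]
    refine le_trans (ENNReal.tsum_le_tsum fun ν => ?_) htail
    rw [← ofReal_norm]
    exact ENNReal.ofReal_le_ofReal
      (le_mul_of_one_le_left (norm_nonneg _) (one_le_prod_sqrt ν.1))
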